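/- All groups are finite. Subgroups $A,B$ of a group $G$ are said to permute if $AB=BA$, and to be mutually permutable if $A$ permutes with every subgroup of $B$ and $B$ permutes with every subgroup of $A$. A Schmidt group is a non-nilpotent group all of whose proper subgroups are nilpotent. A group is supersoluble if it has a finite series $1=N_0\le N_1\le\dots\le N_r=S$ of normal subgroups of the whole group $S$ in which every factor $N_{k+1}/N_k$ is cyclic. Corollary. Let $G$ be a finite group and let $G_1,\dots,G_n$ be subgroups of $G$ such that $G=G_1G_2\cdots G_n$ and, for all $i\neq j$, the subgroups $G_i$ and $G_j$ are mutually permutable. If for every $i$ each Schmidt subgroup of $G_i$ is supersoluble, then every Schmidt subgroup of $G$ is supersoluble. -/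

import Mathlib

open scoped Pointwise

/-- Two subgroups `A` and `B` permute: `AB = BA` as subsets of the group. -/
def SubgroupsPermute {G : Type*} [Group G] (A B : Subgroup G) : Prop :=
  (A : Set G) * (B : Set G) = (B : Set G) * (A : Set G)

/-- `A` and `B` are mutually permutable: `A` permutes with every subgroup of `B`, and `B` permutes
with every subgroup of `A`. -/
def MutuallyPermutable {G : Type*} [Group G] (A B : Subgroup G) : Prop :=
  (∀ U : Subgroup G, U ≤ B → SubgroupsPermute A U) ∧
    (∀ V : Subgroup G, V ≤ A → SubgroupsPermute B V)

/-- `G` is the product `H 0 * H 1 * ⋯ * H (n - 1)` of its pairwise mutually permutable subgroups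
`H i`. -/
def IsPairwiseMutuallyPermutableProduct {G : Type*} [Group G] {n : ℕ}
    (H : Fin n → Subgroup G) : Prop :=
  (List.ofFn fun i => (H i : Set G)).prod = Set.univ ∧
    ∀ i j : Fin n, i ≠ j → MutuallyPermutable (H i) (H j)

/-- A Schmidt group: a non-nilpotent group all of whose proper subgroups are nilpotent. -/
def IsSchmidtGroup (S : Type*) [Group S] : Prop :=
  ¬ Group.IsNilpotent S ∧ ∀ T : Subgroup S, T ≠ ⊤ → Group.IsNilpotent T

/-- A supersoluble group: a group `S` with a finite series `1 = N 0 ≤ N 1 ≤ ⋯ ≤ N r = S` of normal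
subgroups of `S` such that every factor `N (k + 1) / N k` is cyclic. -/
def IsSupersolubleGroup (S : Type*) [Group S] : Prop :=
  ∃ (r : ℕ) (N : ℕ → Subgroup S) (_ : ∀ k, (N k).Normal),
    N 0 = ⊥ ∧ N r = ⊤ ∧
      ∀ k < r, N k ≤ N (k + 1) ∧ IsCyclic (↥(N (k + 1)) ⧸ (N k).subgroupOf (N (k + 1)))

/-- Every Schmidt subgroup of `G` is supersoluble. -/
def SchmidtSubgroupsSupersoluble (G : Type*) [Group G] : Prop :=
  ∀ S : Subgroup G, IsSchmidtGroup S → IsSupersolubleGroup S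

/-! The hypothesis on Schmidt subgroups is traded for a condition on elements,
`CoprimeActionsTrivial`: if q does not divide p - 1, a q-element normalizing a p-subgroup
centralizes it. Supersoluble groups satisfy it, because q does not divide the order of the
automorphism group of a cyclic p-group. A minimal violation U⟨y⟩ is a Schmidt group, so the
condition holds whenever all Schmidt subgroups are supersoluble.

For finite groups this condition is equivalent to `HasSupersolubleTypeTower`, which is stated
through normal subgroups and visibly passes to quotients. The implication towards the tower rests on
Frobenius' normal complement theorem at the smallest prime, which makes the Sylow subgroup for the
largest prime normal, and on induction.

Mutual permutability enters in showing that the tower passes to the product. Let p be the largest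
prime divisor of the order of G and let P_i be the normal Sylow p-subgroup of the i-th factor. The
P_i permute (`permute_normalSylow`), the elements of the factors of prime power order prime to p
normalize all of them (`conj_mem_normalSylow`), and those q-elements with q not dividing p(p - 1)
centralize all of them (`commute_normalSylow`). So the product W of the P_i is a normal Sylow
subgroup with the required action, and G/W is handled by induction.

Finally, a Schmidt group S with a tower is R⟨y⟩ with R a normal r-subgroup and y a q-element
inducing on R an automorphism of order q, where q divides r - 1. Such an automorphism has an
eigenvector on R/C_R(y), and the nilpotency of proper subgroups then forces R to be cyclic; the
series 1 ≤ R ≤ S shows that S is supersoluble. -/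

open scoped Pointwise commutatorElement

/-! ### Elements of prime power order. -/

section PrimaryElements

variable {G : Type*} [Group G]

theorem eq_one_of_pow_prime_pow {p q : ℕ} (hp : p.Prime) (hq : q.Prime) (hpq : p ≠ q) {x : G}
    {j k : ℕ} (h₁ : x ^ p ^ j = 1) (h₂ : x ^ q ^ k = 1) : x = 1 := by
  have hc : Nat.Coprime (p ^ j) (q ^ k) :=
    Nat.Coprime.pow _ _ ((Nat.coprime_primes hp hq).2 hpq)
  rw [← orderOf_eq_one_iff]
  exact Nat.eq_one_of_dvd_coprimes hc (orderOf_dvd_of_pow_eq_one h₁) (orderOf_dvd_of_pow_eq_one h₂)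

theorem exists_pow_prime_pow_eq_one_of_mem {p : ℕ} {U : Subgroup G} (hU : IsPGroup p U) {x : G}
    (hx : x ∈ U) : ∃ k, x ^ p ^ k = 1 := by
  obtain ⟨k, hk⟩ := (isPGroup_iff_pow_pow_eq_one.1 hU) ⟨x, hx⟩
  exact ⟨k, by simpa using congrArg Subtype.val hk⟩

theorem isPGroup_of_forall_mem {p : ℕ} {U : Subgroup G} (h : ∀ x ∈ U, ∃ k, x ^ p ^ k = 1) :
    IsPGroup p U :=
  isPGroup_iff_pow_pow_eq_one.2 fun x => by
    obtain ⟨k, hk⟩ := h x x.2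
    exact ⟨k, Subtype.ext (by simpa using hk)⟩

theorem isPGroup_zpowers_of_pow_eq_one {p k : ℕ} {x : G} (hx : x ^ p ^ k = 1) :
    IsPGroup p (Subgroup.zpowers x) :=
  isPGroup_of_forall_mem fun y hy => by
    obtain ⟨i, rfl⟩ := Subgroup.mem_zpowers_iff.1 hy
    refine ⟨k, ?_⟩
    rw [← zpow_natCast, ← zpow_mul, mul_comm, zpow_mul, zpow_natCast, hx, one_zpow]

theorem exists_primary_pow [Finite G] {q : ℕ} (hq : q.Prime) (x : G) :
    ∃ m, ¬ q ∣ m ∧ ∃ k, (x ^ m) ^ q ^ k = 1 := by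
  have h0 : orderOf x ≠ 0 := (orderOf_pos x).ne'
  refine ⟨ordCompl[q] (orderOf x), Nat.not_dvd_ordCompl hq h0, (orderOf x).factorization q, ?_⟩
  rw [← pow_mul, mul_comm, Nat.ordProj_mul_ordCompl_eq_self, pow_orderOf_eq_one]

/-- A Sylow q-subgroup consists of q-elements, so it lies in `S`. Together with
`mem_of_primary_of_not_dvd_index` this lets index conditions on normal subgroups be checked on
elements. -/
theorem not_dvd_index_of_primary_mem [Finite G] {q : ℕ} (hq : q.Prime) {S : Subgroup G}
    (h : ∀ (x : G) (k : ℕ), x ^ q ^ k = 1 → x ∈ S) : ¬ q ∣ S.index := by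
  have := Fact.mk hq
  let Q : Sylow q G := default
  have hQ : (Q : Subgroup G) ≤ S := fun x hx => by
    obtain ⟨k, hk⟩ := exists_pow_prime_pow_eq_one_of_mem Q.isPGroup' hx
    exact h x k hk
  exact fun hd => Q.not_dvd_index (hd.trans (Subgroup.index_dvd_of_le hQ))

theorem eq_top_of_primary_mem [Finite G] {S : Subgroup G}
    (h : ∀ q : ℕ, q.Prime → ∀ (x : G) (k : ℕ), x ^ q ^ k = 1 → x ∈ S) : S = ⊤ := by
  rw [← Subgroup.index_eq_one]
  by_contra h1
  obtain ⟨q, hq, hd⟩ := Nat.exists_prime_and_dvd h1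
  exact not_dvd_index_of_primary_mem hq (h q hq) hd

theorem le_of_primary_mem [Finite G] {A S : Subgroup G}
    (h : ∀ q : ℕ, q.Prime → ∀ x ∈ A, ∀ k : ℕ, x ^ q ^ k = 1 → x ∈ S) : A ≤ S := by
  rw [← Subgroup.subgroupOf_eq_top]
  refine eq_top_of_primary_mem fun q hq x k hx => ?_
  exact h q hq x x.2 k (by simpa using congrArg Subtype.val hx)

theorem mem_of_primary_of_not_dvd_index {q k : ℕ} (hq : q.Prime) {N : Subgroup G} [N.Normal]
    (hN : ¬ q ∣ N.index) {x : G} (hx : x ^ q ^ k = 1) : x ∈ N := by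
  rw [← QuotientGroup.eq_one_iff, ← orderOf_eq_one_iff]
  have h1 : orderOf (x : G ⧸ N) ∣ q ^ k :=
    orderOf_dvd_of_pow_eq_one (by rw [← QuotientGroup.mk_pow, hx, QuotientGroup.mk_one])
  have h2 : orderOf (x : G ⧸ N) ∣ N.index := by
    rw [Subgroup.index]; exact orderOf_dvd_natCard _
  exact Nat.eq_one_of_dvd_coprimes
    (Nat.Coprime.pow_left k ((Nat.Prime.coprime_iff_not_dvd hq).2 hN)) h1 h2

theorem dvd_card_of_primary_mem {q k : ℕ} (hq : q.Prime) {N : Subgroup G} {x : G}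
    (hxN : x ∈ N) (hx : x ^ q ^ k = 1) (hx1 : x ≠ 1) : q ∣ Nat.card N := by
  obtain ⟨j, -, hj⟩ := (Nat.dvd_prime_pow hq).1 (orderOf_dvd_of_pow_eq_one hx)
  have hj0 : j ≠ 0 := by
    rintro rfl
    exact hx1 (orderOf_eq_one_iff.1 (by simpa using hj))
  refine ((dvd_pow_self q hj0).trans hj.symm.dvd).trans ?_
  rw [← Subgroup.orderOf_mk x hxN]
  exact orderOf_dvd_natCard _

theorem isPGroup_of_forall_prime_dvd [Finite G] {p : ℕ} (hp : p.Prime)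
    (h : ∀ s : ℕ, s.Prime → s ∣ Nat.card G → s = p) : IsPGroup p G := by
  refine (isPGroup_iff_primeFactors_card_subset hp.ne_zero).2 fun s hs => ?_
  rw [h s (Nat.prime_of_mem_primeFactors hs) (Nat.dvd_of_mem_primeFactors hs)]
  simp [hp]

theorem eq_of_prime_dvd_card_of_isPGroup [Finite G] {p s : ℕ} (hp : p.Prime) (hs : s.Prime)
    (h : IsPGroup p G) (hd : s ∣ Nat.card G) : s = p := by
  have := Fact.mk hp
  obtain ⟨n, hn⟩ := IsPGroup.iff_card.1 h
  exact (Nat.prime_dvd_prime_iff_eq hs hp).1 (hs.dvd_of_dvd_pow (hn ▸ hd))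

/-- If `y` is a `q`-element, `d` is a `p`-element commuting with `y` and `y u y⁻¹ = u d`, then
`d = 1`. -/
theorem eq_one_of_conj_eq_mul {p q j k : ℕ} (hp : p.Prime) (hq : q.Prime) (hpq : p ≠ q)
    {y u d : G} (hy : y ^ q ^ k = 1) (hd : d ^ p ^ j = 1) (hyd : Commute y d)
    (h : y * u * y⁻¹ = u * d) : d = 1 := by
  have key : ∀ n : ℕ, y ^ n * u * (y ^ n)⁻¹ = u * d ^ n := by
    intro n
    induction n with
    | zero => simp
    | succ n ih =>
      have h1 : y ^ (n + 1) * u * (y ^ (n + 1))⁻¹ = y * (y ^ n * u * (y ^ n)⁻¹) * y⁻¹ := by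
        rw [pow_succ']; group
      have h2 : y * d ^ n * y⁻¹ = d ^ n := by
        rw [(hyd.pow_right n).eq, mul_inv_cancel_right]
      calc y ^ (n + 1) * u * (y ^ (n + 1))⁻¹ = y * (u * d ^ n) * y⁻¹ := by rw [h1, ih]
        _ = (y * u * y⁻¹) * (y * d ^ n * y⁻¹) := by group
        _ = u * d ^ (n + 1) := by rw [h, h2, mul_assoc, ← pow_succ']
  have := key (q ^ k)
  rw [hy] at this
  exact eq_one_of_pow_prime_pow hp hq hpq hd (by simpa using this)

end PrimaryElements

/-! ### Nilpotency as commutation of elements of coprime prime power orders. -/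

section Nilpotent

variable {G : Type*} [Group G] [Finite G]

theorem commute_of_isNilpotent (hG : Group.IsNilpotent G) {p q j k : ℕ} (hp : p.Prime)
    (hq : q.Prime) (hpq : p ≠ q) {x y : G} (hx : x ^ p ^ j = 1) (hy : y ^ q ^ k = 1) :
    Commute x y := by
  have := Fact.mk hp
  have := Fact.mk hq
  have hS := (Group.isNilpotent_of_finite_tfae (G := G).out 0 3 rfl rfl).1 hG
  obtain ⟨P, hP⟩ := (isPGroup_zpowers_of_pow_eq_one hx).exists_le_sylow
  obtain ⟨Q, hQ⟩ := (isPGroup_zpowers_of_pow_eq_one hy).exists_le_sylow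
  exact Subgroup.commute_of_normal_of_disjoint _ _ (hS p ‹_› P) (hS q ‹_› Q)
    (IsPGroup.disjoint_of_ne p q hpq _ _ P.isPGroup' Q.isPGroup') x y
    (hP (Subgroup.mem_zpowers x)) (hQ (Subgroup.mem_zpowers y))

/-- The normalizer of a Sylow p-subgroup contains that subgroup and every q-element with q ≠ p, so
no prime divides its index. -/
theorem isNilpotent_of_primary_commute
    (h : ∀ p q : ℕ, p.Prime → q.Prime → p ≠ q → ∀ (x y : G) (j k : ℕ),
      x ^ p ^ j = 1 → y ^ q ^ k = 1 → Commute x y) : Group.IsNilpotent G := by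
  refine (Group.isNilpotent_of_finite_tfae (G := G).out 0 3 rfl rfl).2 fun p hp P => ?_
  rw [← Subgroup.normalizer_eq_top_iff, ← Subgroup.index_eq_one]
  by_contra h1
  obtain ⟨q, hq, hd⟩ := Nat.exists_prime_and_dvd h1
  by_cases hqp : q = p
  · subst hqp
    exact P.not_dvd_index (hd.trans (Subgroup.index_dvd_of_le Subgroup.le_normalizer))
  · refine not_dvd_index_of_primary_mem hq (fun y k hy => ?_) hd
    refine (Subgroup.centralizer_le_normalizer _) ?_
    rw [Subgroup.mem_centralizer_iff]
    intro x hx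
    obtain ⟨j, hj⟩ := exists_pow_prime_pow_eq_one_of_mem P.isPGroup' hx
    exact h p q hp.out hq (Ne.symm hqp) x y j k hj hy

end Nilpotent

/-! ### Coprime actions in supersoluble groups. -/

/-- For all primes `p ≠ q` such that `q` does not divide `p - 1`, every `q`-element normalizing a
`p`-subgroup centralizes it. -/
def CoprimeActionsTrivial (G : Type*) [Group G] : Prop :=
  ∀ p q : ℕ, p.Prime → q.Prime → p ≠ q → ¬ q ∣ p - 1 → ∀ U : Subgroup G, IsPGroup p U →
    ∀ (y : G) (k : ℕ), y ^ q ^ k = 1 → (∀ u ∈ U, y * u * y⁻¹ ∈ U) → ∀ u ∈ U, Commute y u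

/-- Conjugation by `z` is a unit modulo the order p^l of `w`. The order of this unit divides both
q^k and φ(p^l), which are coprime. -/
theorem commute_of_conj_eq_zpow {Q : Type*} [Group Q] {p q j k : ℕ} (hp : p.Prime) (hq : q.Prime)
    (hpq : p ≠ q) (hqp : ¬ q ∣ p - 1) {z w : Q} (hz : z ^ q ^ k = 1) (hw : w ^ p ^ j = 1) {m : ℤ}
    (h : z * w * z⁻¹ = w ^ m) : Commute z w := by
  have key : ∀ n : ℕ, z ^ n * w * (z ^ n)⁻¹ = w ^ (m ^ n) := by
    intro n
    induction n with
    | zero => simp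
    | succ n ih =>
      calc z ^ (n + 1) * w * (z ^ (n + 1))⁻¹ = z * (z ^ n * w * (z ^ n)⁻¹) * z⁻¹ := by
            rw [pow_succ']; group
        _ = w ^ (m ^ (n + 1)) := by
            rw [ih, ← conj_zpow, h, ← zpow_mul, pow_succ']
  have h1 : w ^ (m ^ q ^ k) = w ^ (1 : ℤ) := by
    have := key (q ^ k)
    rw [hz] at this
    simpa using this.symm
  obtain ⟨l, -, hl⟩ := (Nat.dvd_prime_pow hp).1 (orderOf_dvd_of_pow_eq_one hw)
  have : NeZero (orderOf w) := ⟨by rw [hl]; exact pow_ne_zero _ hp.ne_zero⟩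
  have h2 : ((m : ZMod (orderOf w))) ^ q ^ k = 1 := by
    have := (ZMod.intCast_eq_intCast_iff _ _ _).2 (zpow_eq_zpow_iff_modEq.1 h1)
    simpa using this
  let u : (ZMod (orderOf w))ˣ := Units.ofPowEqOne _ _ h2 (pow_ne_zero _ hq.ne_zero)
  have hu : u ^ q ^ k = 1 := Units.pow_ofPowEqOne _ _
  have hcard : orderOf u ∣ (orderOf w).totient := by
    rw [← ZMod.card_units_eq_totient]
    exact orderOf_dvd_card
  have hcop : Nat.Coprime (q ^ k) (orderOf w).totient := by
    refine Nat.Coprime.pow_left k ((Nat.Prime.coprime_iff_not_dvd hq).2 fun hd => ?_)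
    rw [hl] at hd
    rcases Nat.eq_zero_or_pos l with rfl | hl0
    · simp at hd
      exact hq.one_lt.ne' hd
    · rw [Nat.totient_prime_pow hp hl0] at hd
      rcases hq.dvd_mul.1 hd with hd | hd
      · exact hpq ((Nat.prime_dvd_prime_iff_eq hq hp).1 (hq.dvd_of_dvd_pow hd)).symm
      · exact hqp hd
  have hu1 : u = 1 := orderOf_eq_one_iff.1
    (Nat.eq_one_of_dvd_coprimes hcop (orderOf_dvd_of_pow_eq_one hu) hcard)
  have hm : (m : ZMod (orderOf w)) = ((1 : ℤ) : ZMod (orderOf w)) := by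
    have := congrArg Units.val hu1
    simpa [u] using this
  have h3 : w ^ m = w ^ (1 : ℤ) :=
    zpow_eq_zpow_iff_modEq.2 ((ZMod.intCast_eq_intCast_iff _ _ _).1 hm)
  rw [h3, zpow_one] at h
  exact mul_inv_eq_iff_eq_mul.1 h

/-- Induction up the series. Modulo `N i` the element `u` lies in a cyclic normal subgroup, so `y`
centralizes it there; the resulting commutator lies in U ∩ N i, commutes with `y` by induction, and
is therefore trivial by `eq_one_of_conj_eq_mul`. -/
theorem IsSupersolubleGroup.coprimeActionsTrivial {S : Type*} [Group S]
    (hS : IsSupersolubleGroup S) : CoprimeActionsTrivial S := by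
  obtain ⟨r, N, hN, h0, hr, hc⟩ := hS
  intro p q hp hq hpq hqp U hU y k hy hyU
  suffices H : ∀ i ≤ r, ∀ u ∈ U, u ∈ N i → Commute y u from
    fun u hu => H r le_rfl u hu (hr ▸ Subgroup.mem_top u)
  intro i
  induction i with
  | zero =>
    intro _ u _ hu
    rw [h0, Subgroup.mem_bot] at hu
    rw [hu]
    exact Commute.one_right y
  | succ i ih =>
    intro hi u hu huN
    obtain ⟨hle, hcyc⟩ := hc i (by omega)
    obtain ⟨g, hg⟩ := hcyc.exists_generator
    obtain ⟨g, rfl⟩ := QuotientGroup.mk_surjective g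
    let f := QuotientGroup.mk' (N i)
    have hgen : ∀ x ∈ N (i + 1), ∃ a : ℤ, f x = f g ^ a := by
      intro x hx
      obtain ⟨a, ha⟩ := Subgroup.mem_zpowers_iff.1 (hg (QuotientGroup.mk ⟨x, hx⟩))
      refine ⟨a, ?_⟩
      rw [← QuotientGroup.mk_zpow, QuotientGroup.eq, Subgroup.mem_subgroupOf] at ha
      rw [← map_zpow]
      exact (QuotientGroup.eq.2 (by simpa using ha)).symm
    obtain ⟨m, hm⟩ := hgen _ ((hN (i + 1)).conj_mem g g.2 y)
    obtain ⟨a, ha⟩ := hgen u huN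
    obtain ⟨j, hj⟩ := exists_pow_prime_pow_eq_one_of_mem hU hu
    have hcm : Commute (f y) (f u) := by
      refine commute_of_conj_eq_zpow hp hq hpq hqp (k := k) (j := j) (m := m) ?_ ?_ ?_
      · rw [← map_pow, hy, map_one]
      · rw [← map_pow, hj, map_one]
      · rw [ha, ← conj_zpow, ← map_inv, ← map_mul, ← map_mul, hm, ← zpow_mul, ← zpow_mul,
          mul_comm]
    have hd : u⁻¹ * (y * u * y⁻¹) ∈ N i := by
      rw [← QuotientGroup.eq]
      change f u = f (y * u * y⁻¹)
      rw [map_mul, map_mul, map_inv, hcm.eq, mul_inv_cancel_right]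
    have hdU : u⁻¹ * (y * u * y⁻¹) ∈ U := U.mul_mem (U.inv_mem hu) (hyU u hu)
    obtain ⟨l, hl⟩ := exists_pow_prime_pow_eq_one_of_mem hU hdU
    have h1 := eq_one_of_conj_eq_mul hp hq hpq (u := u) hy hl (ih (by omega) _ hdU hd) (by group)
    rw [inv_mul_eq_one] at h1
    exact mul_inv_eq_iff_eq_mul.1 h1.symm

theorem CoprimeActionsTrivial.subgroup {G : Type*} [Group G] (h : CoprimeActionsTrivial G)
    (A : Subgroup G) : CoprimeActionsTrivial A := by
  intro p q hp hq hpq hqp U hU y k hy hyU u hu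
  have := h p q hp hq hpq hqp (U.map A.subtype) (hU.map _) y k
    (by simpa using congrArg Subtype.val hy)
    (by
      rintro _ ⟨v, hv, rfl⟩
      exact ⟨y * v * y⁻¹, hyU v hv, by simp⟩) u ⟨u, hu, rfl⟩
  exact Subtype.ext this

theorem CoprimeActionsTrivial.commute_of_mem {G : Type*} [Group G] {A : Subgroup G}
    (h : CoprimeActionsTrivial A) {p q k : ℕ} (hp : p.Prime) (hq : q.Prime) (hpq : p ≠ q)
    (hqp : ¬ q ∣ p - 1) {U : Subgroup G} (hU : IsPGroup p U) (hUA : U ≤ A) {y : G} (hyA : y ∈ A)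
    (hy : y ^ q ^ k = 1) (hyU : ∀ u ∈ U, y * u * y⁻¹ ∈ U) {u : G} (hu : u ∈ U) : Commute y u := by
  have := h p q hp hq hpq hqp (U.subgroupOf A) (hU.comap_subtype) ⟨y, hyA⟩ k
    (Subtype.ext (by simpa using hy))
    (fun v hv => by simpa [Subgroup.mem_subgroupOf] using hyU v hv) ⟨u, hUA hu⟩ hu
  exact congrArg Subtype.val this

/-! ### Products U⟨y⟩ of a p-group and a cyclic q-group; minimal violations of the coprime
condition. -/

section SemidirectProduct

variable {G : Type*} [Group G] {p q k : ℕ} {U : Subgroup G} {y : G}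

/-- A `p`-subgroup normalized by an element is normal in the subgroup they generate. -/
theorem sup_zpowers_le_normalizer [Finite G] (hyU : ∀ u ∈ U, y * u * y⁻¹ ∈ U) :
    U ⊔ Subgroup.zpowers y ≤ Subgroup.normalizer (U : Set G) := by
  refine sup_le Subgroup.le_normalizer ?_
  rw [Subgroup.zpowers_le]
  exact Subgroup.mem_normalizer_fintype hyU

theorem exists_mul_zpow_of_mem_sup_zpowers [Finite G] (hyU : ∀ u ∈ U, y * u * y⁻¹ ∈ U) {x : G}
    (hx : x ∈ U ⊔ Subgroup.zpowers y) : ∃ u ∈ U, ∃ i : ℤ, x = u * y ^ i := by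
  have h := Subgroup.coe_mul_of_right_le_normalizer_left U (Subgroup.zpowers y)
    (le_sup_right.trans (sup_zpowers_le_normalizer hyU))
  rw [← SetLike.mem_coe, h] at hx
  obtain ⟨u, hu, v, hv, rfl⟩ := hx
  obtain ⟨i, rfl⟩ := Subgroup.mem_zpowers_iff.1 hv
  exact ⟨u, hu, i, rfl⟩

theorem pow_mem_of_mem_sup_zpowers [Finite G] (hyU : ∀ u ∈ U, y * u * y⁻¹ ∈ U) {n : ℕ}
    (hy : y ^ n = 1) {x : G} (hx : x ∈ U ⊔ Subgroup.zpowers y) : x ^ n ∈ U := by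
  have hN : (U.subgroupOf (U ⊔ Subgroup.zpowers y)).Normal :=
    (Subgroup.normal_subgroupOf_iff_le_normalizer le_sup_left).2 (sup_zpowers_le_normalizer hyU)
  obtain ⟨u, hu, i, hxu⟩ := exists_mul_zpow_of_mem_sup_zpowers hyU hx
  let N := U.subgroupOf (U ⊔ Subgroup.zpowers y)
  let f := QuotientGroup.mk' N
  have hyH : y ∈ U ⊔ Subgroup.zpowers y := Subgroup.mem_sup_right (Subgroup.mem_zpowers y)
  have h1 : f ⟨x, hx⟩ = f ⟨y, hyH⟩ ^ i := by
    have : (⟨x, hx⟩ : ↥(U ⊔ Subgroup.zpowers y)) = ⟨u, Subgroup.mem_sup_left hu⟩ * ⟨y, hyH⟩ ^ i :=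
      Subtype.ext (by simpa using hxu)
    have hu1 : f ⟨u, Subgroup.mem_sup_left hu⟩ = 1 := (QuotientGroup.eq_one_iff (N := N) _).2 hu
    rw [this, map_mul, map_zpow, hu1, one_mul]
  have h2 : f ⟨y, hyH⟩ ^ n = 1 := by
    rw [← map_pow, ← map_one f]
    exact congrArg f (Subtype.ext (by simpa using hy))
  have h3 : f (⟨x, hx⟩ ^ n) = 1 := by
    rw [map_pow, h1, ← zpow_natCast, ← zpow_mul, mul_comm, zpow_mul, zpow_natCast, h2, one_zpow]
  exact (QuotientGroup.eq_one_iff (N := N) _).1 h3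

theorem mem_of_mem_sup_zpowers_of_primary [Finite G] (hp : p.Prime) (hq : q.Prime) (hpq : p ≠ q)
    (hyU : ∀ u ∈ U, y * u * y⁻¹ ∈ U) (hy : y ^ q ^ k = 1) {x : G}
    (hx : x ∈ U ⊔ Subgroup.zpowers y) {j : ℕ} (hxj : x ^ p ^ j = 1) : x ∈ U := by
  have h1 := pow_mem_of_mem_sup_zpowers hyU hy hx
  have hc : Nat.Coprime (p ^ j) (q ^ k) :=
    Nat.Coprime.pow _ _ ((Nat.coprime_primes hp hq).2 hpq)
  -- By Bézout, `x` is a power of x^(q^k), which lies in `U`.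
  have h2 := Nat.gcd_eq_gcd_ab (p ^ j) (q ^ k)
  rw [hc] at h2
  have h3 : x = (x ^ q ^ k) ^ ((p ^ j).gcdB (q ^ k)) := by
    conv_lhs => rw [← zpow_one x, show (1 : ℤ) = ((1 : ℕ) : ℤ) from rfl, h2, zpow_add, zpow_mul,
      zpow_mul, zpow_natCast, hxj, one_zpow, one_mul, zpow_natCast]
  rw [h3]
  exact U.zpow_mem h1 _

theorem eq_one_of_mem_sup_zpowers [Finite G] (hU : IsPGroup p U) (hp : p.Prime) (hq : q.Prime)
    {s : ℕ} (hs : s.Prime) (hsp : s ≠ p) (hsq : s ≠ q) (hyU : ∀ u ∈ U, y * u * y⁻¹ ∈ U)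
    (hy : y ^ q ^ k = 1) {x : G} (hx : x ∈ U ⊔ Subgroup.zpowers y) {l : ℕ} (hxl : x ^ s ^ l = 1) :
    x = 1 := by
  have h1 := mem_of_mem_sup_zpowers_of_primary hs hq hsq hyU hy hx hxl
  obtain ⟨j, hj⟩ := exists_pow_prime_pow_eq_one_of_mem hU h1
  exact eq_one_of_pow_prime_pow hp hs hsp.symm hj hxl

/-- Nilpotency of a subgroup of `U ⟨y⟩`, with `U` a `p`-group and `y` a `q`-element. -/
theorem isNilpotent_of_le_sup_zpowers [Finite G] (hU : IsPGroup p U) (hp : p.Prime)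
    (hq : q.Prime) (hyU : ∀ u ∈ U, y * u * y⁻¹ ∈ U) (hy : y ^ q ^ k = 1)
    {T : Subgroup G} (hT : T ≤ U ⊔ Subgroup.zpowers y) (hpq : p ≠ q)
    (h : ∀ x ∈ T, x ∈ U → ∀ z ∈ T, ∀ l : ℕ, z ^ q ^ l = 1 → Commute x z) :
    Group.IsNilpotent T := by
  refine isNilpotent_of_primary_commute fun p' q' hp' hq' hpq' x z j l hx hz => ?_
  have hx' : (x : G) ^ p' ^ j = 1 := by simpa using congrArg Subtype.val hx
  have hz' : (z : G) ^ q' ^ l = 1 := by simpa using congrArg Subtype.val hz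
  have one {s : ℕ} (hs : s.Prime) (hsp : s ≠ p) (hsq : s ≠ q) {w : T} {l : ℕ}
      (hw : (w : G) ^ s ^ l = 1) : w = 1 :=
    Subtype.ext (eq_one_of_mem_sup_zpowers hU hp hq hs hsp hsq hyU hy (hT w.2) hw)
  by_cases h1 : p' = p
  · subst h1
    by_cases h2 : q' = q
    · subst h2
      exact Subtype.ext (h x x.2
        (mem_of_mem_sup_zpowers_of_primary hp hq hpq hyU hy (hT x.2) hx') z z.2 l hz')
    · rw [one hq' hpq'.symm h2 hz']
      exact Commute.one_right x
  · by_cases h2 : p' = q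
    · subst h2
      by_cases h3 : q' = p
      · subst h3
        exact (show Commute z x from Subtype.ext (h z z.2
          (mem_of_mem_sup_zpowers_of_primary hp hq hpq hyU hy (hT z.2) hz') x x.2 j hx')).symm
      · rw [one hq' h3 hpq'.symm hz']
        exact Commute.one_right x
    · rw [one hp' h1 h2 hx']
      exact Commute.one_left z

end SemidirectProduct

/-- In a violation with U⟨y⟩ of least order, minimality makes every proper subgroup of U⟨y⟩
nilpotent. Thus U⟨y⟩ is a Schmidt group, hence supersoluble, and no violation is possible in it. -/
theorem SchmidtSubgroupsSupersoluble.coprimeActionsTrivial {G : Type*} [Group G] [Finite G]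
    (hG : SchmidtSubgroupsSupersoluble G) : CoprimeActionsTrivial G := by
  intro p q hp hq hpq hqp
  suffices H : ∀ (n : ℕ) (U : Subgroup G) (y : G), Nat.card ↥(U ⊔ Subgroup.zpowers y) = n →
      IsPGroup p U → ∀ k : ℕ, y ^ q ^ k = 1 → (∀ u ∈ U, y * u * y⁻¹ ∈ U) →
      ∀ u ∈ U, Commute y u from
    fun U hU y k hy hyU u hu => H _ U y rfl hU k hy hyU u hu
  intro n
  induction n using Nat.strong_induction_on with
  | _ n ih =>
  intro U y hn hU k hy hyU u hu
  by_contra hyu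
  let H := U ⊔ Subgroup.zpowers y
  have hUH : U ≤ H := le_sup_left
  have hyH : y ∈ H := Subgroup.mem_sup_right (Subgroup.mem_zpowers y)
  obtain ⟨j, hj⟩ := exists_pow_prime_pow_eq_one_of_mem hU hu
  have hS : IsSchmidtGroup H := by
    refine ⟨fun hnil => hyu ?_, fun T hT => ?_⟩
    · have := commute_of_isNilpotent hnil hq hp hpq.symm (x := ⟨y, hyH⟩) (y := ⟨u, hUH hu⟩)
        (j := k) (k := j) (Subtype.ext (by simpa using hy)) (Subtype.ext (by simpa using hj))
      exact congrArg Subtype.val this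
    · let T' := T.map H.subtype
      have hT'H : T' ≤ H := Subgroup.map_subtype_le T
      have hne : T' ≠ H := fun he => hT (by
        rw [eq_top_iff]
        intro x _
        obtain ⟨t, ht, htx⟩ := he.ge x.2
        rwa [← Subtype.ext (show (t : G) = x from htx)])
      have hlt : Nat.card T' < n := by
        rw [← hn]
        refine lt_of_le_of_ne (Subgroup.card_le_of_le hT'H) fun he => hne ?_
        exact Subgroup.eq_of_le_of_card_ge hT'H he.ge
      have hnil : Group.IsNilpotent T' := by
        refine isNilpotent_of_le_sup_zpowers hU hp hq hyU hy hT'H hpq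
          fun x hx hxU z hz l hzl => ?_
        -- The pair (T' ∩ U, z) generates a subgroup of the proper subgroup `T'`, so induction
        -- applies to it.
        refine (ih _ ?_ (T' ⊓ U) z rfl (hU.to_le inf_le_right) l hzl ?_ x ⟨hx, hxU⟩).symm
        · refine lt_of_le_of_lt (Subgroup.card_le_of_le ?_) hlt
          exact sup_le inf_le_left (by rwa [Subgroup.zpowers_le])
        · intro v hv
          refine ⟨T'.mul_mem (T'.mul_mem hz hv.1) (T'.inv_mem hz), ?_⟩
          exact (Subgroup.mem_normalizer_iff.1 (sup_zpowers_le_normalizer hyU (hT'H hz)) v).1 hv.2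
      exact (Group.isNilpotent_congr (T.equivMapOfInjective _ H.subtype_injective)).2 hnil
  exact hyu (CoprimeActionsTrivial.commute_of_mem (hG H hS).coprimeActionsTrivial hp hq hpq hqp hU
    hUH hyH hy hyU hu)

/-! ### Fusion and Frobenius' normal p-complement theorem. -/

theorem IsPGroup.lt_inf_normalizer {G : Type*} [Group G] [Finite G] {p : ℕ} [Fact p.Prime]
    {D P : Subgroup G} (hP : IsPGroup p P) (hD : D < P) :
    D < P ⊓ Subgroup.normalizer (D : Set G) := by
  have hnc : NormalizerCondition P :=
    (Group.isNilpotent_of_finite_tfae.out 0 1 rfl rfl).1 hP.isNilpotent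
  have h1 : D.subgroupOf P < ⊤ := by
    rw [lt_top_iff_ne_top, Ne, Subgroup.subgroupOf_eq_top]
    exact hD.not_ge
  obtain ⟨x, hx, hxD⟩ := SetLike.exists_of_lt (hnc _ h1)
  rw [← Subgroup.subgroupOf_normalizer_eq hD.le] at hx
  exact lt_of_le_of_ne (le_inf hD.le Subgroup.le_normalizer) fun he =>
    hxD (he.ge ⟨x.2, hx⟩)

theorem Sylow.mem_smul_iff {G : Type*} [Group G] {p : ℕ} {P : Sylow p G} {c x : G} :
    x ∈ (c • P : Sylow p G).toSubgroup ↔ c⁻¹ * x * c ∈ P.toSubgroup := by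
  rw [Sylow.coe_subgroup_smul, Subgroup.mem_pointwise_smul_iff_inv_smul_mem,
    MulAut.smul_def, ← map_inv, MulAut.conj_apply, inv_inv]

/-- Every `p'`-element of prime power order normalizing a `p`-subgroup centralizes it. -/
def FrobeniusCondition (p : ℕ) (G : Type*) [Group G] : Prop :=
  ∀ U : Subgroup G, IsPGroup p U → ∀ q : ℕ, q.Prime → q ≠ p → ∀ (y : G) (k : ℕ),
    y ^ q ^ k = 1 → (∀ u ∈ U, y * u * y⁻¹ ∈ U) → ∀ u ∈ U, Commute y u

namespace FrobeniusCondition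

theorem subgroup {p : ℕ} {G : Type*} [Group G] (h : FrobeniusCondition p G)
    (A : Subgroup G) : FrobeniusCondition p A := by
  intro U hU q hq hqp y k hy hyU u hu
  have := h (U.map A.subtype) (hU.map _) q hq hqp y k
    (by simpa using congrArg Subtype.val hy)
    (by
      rintro _ ⟨v, hv, rfl⟩
      exact ⟨y * v * y⁻¹, hyU v hv, by simp⟩) u ⟨u, hu, rfl⟩
  exact Subtype.ext this

variable {G : Type*} [Group G] [Finite G] {p : ℕ} [hp : Fact p.Prime]

/-- The centralizer of `U` contains every q-element of the normalizer for q ≠ p, and `S` accounts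
for the prime p, so no prime divides the index of their product. -/
theorem exists_centralizer_mul (h : FrobeniusCondition p G) {U : Subgroup G} (hU : IsPGroup p U)
    (S : Sylow p (Subgroup.normalizer (U : Set G))) (n : Subgroup.normalizer (U : Set G)) :
    ∃ c s : Subgroup.normalizer (U : Set G),
      (c : G) ∈ Subgroup.centralizer (U : Set G) ∧ s ∈ S ∧ n = c * s := by
  let C := (Subgroup.centralizer (U : Set G)).subgroupOf (Subgroup.normalizer (U : Set G))
  have hC : C.Normal := by
    have h1 : U.normalizerMonoidHom.ker = C := U.normalizerMonoidHom_ker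
    rw [← h1]
    infer_instance
  have htop : C ⊔ (S : Subgroup _) = ⊤ := by
    rw [← Subgroup.index_eq_one]
    by_contra h1
    obtain ⟨q, hq, hd⟩ := Nat.exists_prime_and_dvd h1
    by_cases hqp : q = p
    · subst hqp
      exact S.not_dvd_index (hd.trans (Subgroup.index_dvd_of_le le_sup_right))
    · refine not_dvd_index_of_primary_mem hq (S := C) (fun y k hy => ?_)
        (hd.trans (Subgroup.index_dvd_of_le le_sup_left))
      rw [Subgroup.mem_subgroupOf, Subgroup.mem_centralizer_iff]
      exact fun u hu => (h U hU q hq hqp y k (by simpa using congrArg Subtype.val hy)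
        (fun v hv => (Subgroup.mem_normalizer_iff.1 y.2 v).1 hv) u hu).symm
  obtain ⟨c, hc, s, hs, hcs⟩ := Subgroup.mem_sup_of_normal_left.1 (htop ▸ Subgroup.mem_top n)
  exact ⟨c, s, hc, hs, hcs.symm⟩

/-- Downward induction on the order of D = P ∩ Q. Sylow subgroups of N(D) containing P ∩ N(D) and Q
∩ N(D) are conjugate by an element that can be chosen in C(D). Since normalizers grow in p-groups,
this links `P` to `Q` through pairs of Sylow subgroups with larger intersections. -/
theorem exists_centralizer_smul_eq (h : FrobeniusCondition p G) (P Q : Sylow p G) :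
    ∃ c ∈ Subgroup.centralizer ((P ⊓ Q : Subgroup G) : Set G), c • P = Q := by
  suffices H : ∀ (n : ℕ) (P Q : Sylow p G), Nat.card G - Nat.card (P ⊓ Q : Subgroup G) = n →
      ∃ c ∈ Subgroup.centralizer ((P ⊓ Q : Subgroup G) : Set G), c • P = Q from H _ P Q rfl
  intro n
  induction n using Nat.strong_induction_on with
  | _ n ih =>
  intro P Q hn
  by_cases hPQ : P = Q
  · exact ⟨1, Subgroup.one_mem _, by rw [one_smul, hPQ]⟩
  let D : Subgroup G := P ⊓ Q
  have hDP : D < P := lt_of_le_of_ne inf_le_left fun he => hPQ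
    (Sylow.ext (P.is_maximal' Q.isPGroup' (inf_eq_left.1 he))).symm
  have hDQ : D < Q := lt_of_le_of_ne inf_le_right fun he => hPQ
    (Sylow.ext (Q.is_maximal' P.isPGroup' (inf_eq_right.1 he)))
  let N := Subgroup.normalizer (D : Set G)
  obtain ⟨S, hS⟩ := (P.isPGroup'.to_le (H := P ⊓ N) inf_le_left).comap_subtype (K := N)
    |>.exists_le_sylow
  obtain ⟨T, hT⟩ := (Q.isPGroup'.to_le (H := Q ⊓ N) inf_le_left).comap_subtype (K := N)
    |>.exists_le_sylow
  obtain ⟨m, hm⟩ := MulAction.exists_smul_eq N S T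
  obtain ⟨c, s, hc, hs, rfl⟩ := h.exists_centralizer_mul (P.isPGroup'.to_le hDP.le) S m
  obtain ⟨P₁, hP₁⟩ := (S.isPGroup'.map N.subtype).exists_le_sylow
  have hsS : s • S = S := Sylow.smul_eq_iff_mem_normalizer.2 (Subgroup.le_normalizer hs)
  rw [mul_smul, hsS] at hm
  have hPP₁ : D < P.toSubgroup ⊓ P₁.toSubgroup := lt_of_lt_of_le (P.isPGroup'.lt_inf_normalizer hDP)
    (le_inf inf_le_left fun x hx => hP₁ ⟨⟨x, hx.2⟩, hS hx, rfl⟩)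
  have hQQ₁ : D < ((c : G) • P₁ : Sylow p G).toSubgroup ⊓ Q.toSubgroup := by
    refine lt_of_lt_of_le (Q.isPGroup'.lt_inf_normalizer hDQ) (le_inf (fun x hx => ?_) inf_le_left)
    have hxT : (⟨x, hx.2⟩ : N) ∈ T.toSubgroup := hT hx
    rw [← hm, Sylow.mem_smul_iff] at hxT
    exact Sylow.mem_smul_iff.2 (hP₁ ⟨_, hxT, by simp⟩)
  have lt {A : Subgroup G} (hA : D < A) : Nat.card G - Nat.card A < n := by
    have h1 : Nat.card D < Nat.card A :=
      lt_of_le_of_ne (Subgroup.card_le_of_le hA.le) fun he =>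
        hA.ne (Subgroup.eq_of_le_of_card_ge hA.le he.ge)
    have h2 := Subgroup.card_le_card_group A
    have h3 : Nat.card G - Nat.card D = n := hn
    omega
  obtain ⟨c₁, hc₁, h₁⟩ := ih _ (lt hPP₁) P P₁ rfl
  obtain ⟨c₂, hc₂, h₂⟩ := ih _ (lt hQQ₁) ((c : G) • P₁) Q rfl
  refine ⟨c₂ * c * c₁, Subgroup.mul_mem _ (Subgroup.mul_mem _ ?_ hc) ?_, ?_⟩
  · exact Subgroup.centralizer_le hQQ₁.le hc₂
  · exact Subgroup.centralizer_le hPP₁.le hc₁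
  · rw [mul_smul, mul_smul, h₁, h₂]

/-- `P` controls its own fusion: `u` can be replaced by some s ∈ P with the same action on `x`.
Indeed `u` times an element centralizing x⁻¹ normalizes `P`, and so is a product of an element
centralizing `P` and an element of `P`. -/
theorem focalSubgroup_le (h : FrobeniusCondition p G) (P : Sylow p G) :
    (P : Subgroup G).focalSubgroup ≤ ⁅(P : Subgroup G), (P : Subgroup G)⁆ := by
  rw [Subgroup.focalSubgroup_def, Subgroup.closure_le]
  rintro _ ⟨hg, x, hx, u, rfl⟩
  have hux : u * x⁻¹ * u⁻¹ ∈ P.toSubgroup := by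
    have := (P : Subgroup G).mul_mem ((P : Subgroup G).inv_mem hx) hg
    rw [commutatorElement_def] at this
    convert this using 1
    group
  obtain ⟨c, hc, hcP⟩ := h.exists_centralizer_smul_eq P (u⁻¹ • P)
  have hx' : x⁻¹ ∈ (P ⊓ (u⁻¹ • P : Sylow p G) : Subgroup G) :=
    ⟨(P : Subgroup G).inv_mem hx, Sylow.mem_smul_iff.2 (by rwa [inv_inv])⟩
  have hn : u * c ∈ Subgroup.normalizer ((P : Subgroup G) : Set G) := by
    refine Sylow.smul_eq_iff_mem_normalizer.1 ?_
    rw [mul_smul, hcP, smul_inv_smul]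
  obtain ⟨d, s, hd, hs, hds⟩ := h.exists_centralizer_mul P.isPGroup'
    (P.subtype Subgroup.le_normalizer) ⟨u * c, hn⟩
  have hsP : (s : G) ∈ P := hs
  have hds' : u * c = d * s := congrArg Subtype.val hds
  have h1 : c * x⁻¹ * c⁻¹ = x⁻¹ := by
    rw [← Subgroup.mem_centralizer_iff.1 hc _ hx', mul_inv_cancel_right]
  have h2 : (s : G) * x⁻¹ * (s : G)⁻¹ ∈ P :=
    (P : Subgroup G).mul_mem ((P : Subgroup G).mul_mem hsP ((P : Subgroup G).inv_mem hx))
      ((P : Subgroup G).inv_mem hsP)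
  have h3 : u * x⁻¹ * u⁻¹ = s * x⁻¹ * (s : G)⁻¹ := by
    calc u * x⁻¹ * u⁻¹ = u * (c * x⁻¹ * c⁻¹) * u⁻¹ := by rw [h1]
      _ = (u * c) * x⁻¹ * (u * c)⁻¹ := by group
      _ = d * (s * x⁻¹ * (s : G)⁻¹) * (d : G)⁻¹ := by rw [hds']; group
      _ = s * x⁻¹ * (s : G)⁻¹ := by
        rw [← Subgroup.mem_centralizer_iff.1 hd _ h2, mul_inv_cancel_right]
  have h4 : ⁅x, u⁆ = ⁅x, (s : G)⁆ := by
    rw [commutatorElement_def, commutatorElement_def]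
    calc x * u * x⁻¹ * u⁻¹ = x * (u * x⁻¹ * u⁻¹) := by group
      _ = _ := by rw [h3]; group
  rw [SetLike.mem_coe, h4]
  exact Subgroup.commutator_mem_commutator hx hsP

theorem focalSubgroupOf_ne_top (h : FrobeniusCondition p G) (P : Sylow p G)
    (hP : p ∣ Nat.card G) : (P : Subgroup G).focalSubgroupOf ≠ ⊤ := by
  intro he
  have hne : (P : Subgroup G) ≠ ⊥ := P.ne_bot_of_dvd_card hP
  have hnt : Nontrivial (P : Subgroup G) := (Subgroup.nontrivial_iff_ne_bot _).2 hne
  have hnil : Group.IsNilpotent (P : Subgroup G) := P.isPGroup'.isNilpotent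
  have hle : (P : Subgroup G) ≤ ⁅(P : Subgroup G), (P : Subgroup G)⁆ := by
    refine le_trans ?_ (h.focalSubgroup_le P)
    rwa [Subgroup.focalSubgroupOf_def, Subgroup.subgroupOf_eq_top] at he
  have hlt := Group.IsSolvable.commutator_lt_top_of_nontrivial (P : Subgroup G)
  refine hlt.not_ge fun x _ => ?_
  obtain ⟨y, hy, hyx⟩ := (Subgroup.map_subtype_commutator (P : Subgroup G)).ge (hle x.2)
  rwa [← Subtype.ext (show (y : G) = x from hyx)]

end FrobeniusCondition

/-- **Frobenius' normal `p`-complement theorem**. -/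
theorem FrobeniusCondition.exists_normal_complement {p : ℕ} [hp : Fact p.Prime] {G : Type*}
    [Group G] [Finite G] (h : FrobeniusCondition p G) :
    ∃ K : Subgroup G, K.Normal ∧ ¬ p ∣ Nat.card K ∧ ∀ s : ℕ, s.Prime → s ∣ K.index → s = p := by
  induction hn : Nat.card G using Nat.strong_induction_on generalizing G with
  | _ n ih =>
  by_cases hpG : p ∣ Nat.card G
  swap
  · refine ⟨⊤, inferInstance, by rwa [Subgroup.card_top], fun s hs hd => ?_⟩
    rw [Subgroup.index_top] at hd
    exact absurd (Nat.dvd_one.1 hd) hs.ne_one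
  let P : Sylow p G := default
  -- The transfer kernel has p-power index and is proper because the focal subgroup is not all of
  -- `P`; the complement is found inside it by induction.
  let M := (P : Subgroup G).transferFocal.ker
  have hM : ∀ s : ℕ, s.Prime → s ∣ M.index → s = p := fun s hs hd =>
    eq_of_prime_dvd_card_of_isPGroup hp.out hs
      (((P.isPGroup'.to_quotient _)).of_equiv
        (Subgroup.transferFocal.quotientKerMulEquivQuotientFocalSubroupOf P).symm) hd
  have hMne : M ≠ ⊤ := by
    intro hM1
    refine h.focalSubgroupOf_ne_top P hpG ?_
    rw [← Subgroup.ker_restrict_transferFocal_eq_focalSubgroupOf, eq_top_iff]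
    intro x _
    have hx : (x : G) ∈ M := hM1 ▸ Subgroup.mem_top _
    exact hx
  have hlt : Nat.card M < n := by
    rw [← hn]
    exact lt_of_le_of_ne (Subgroup.card_le_card_group M) fun he =>
      hMne (Subgroup.eq_top_of_card_eq M he)
  obtain ⟨K, hK, hpK, hKi⟩ := ih _ hlt (h.subgroup M) rfl
  have hcard : Nat.card (K.map M.subtype) = Nat.card K :=
    Subgroup.card_map_of_injective M.subtype_injective
  refine ⟨K.map M.subtype, ⟨fun x hx g => ?_⟩, by rwa [hcard], fun s hs hd => ?_⟩
  · suffices hle : (K.map M.subtype).map (MulAut.conj g).toMonoidHom ≤ K.map M.subtype from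
      hle ⟨x, hx, rfl⟩
    -- A conjugate of `K` lies in `M` and has order prime to p, while `K` contains every q-element
    -- of `M` with q ≠ p.
    refine le_of_primary_mem fun q hq z hz k hzk => ?_
    have hzM : z ∈ M := by
      obtain ⟨_, ⟨w, hw, rfl⟩, rfl⟩ := hz
      exact (inferInstance : M.Normal).conj_mem w w.2 g
    by_cases hqp : q = p
    · subst hqp
      by_cases hz1 : z = 1
      · rw [hz1]
        exact Subgroup.one_mem _
      · refine absurd (dvd_card_of_primary_mem hq hz hzk hz1) ?_
        rwa [Subgroup.card_map_of_injective (MulAut.conj g).injective, hcard]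
    · have : (⟨z, hzM⟩ : M) ∈ K := mem_of_primary_of_not_dvd_index hq
        (fun hd => hqp (hKi q hq hd)) (k := k) (Subtype.ext (by simpa using hzk))
      exact ⟨_, this, rfl⟩
  · rw [Subgroup.index_map_subtype] at hd
    rcases hs.dvd_mul.1 hd with hd | hd
    · exact hKi s hs hd
    · exact hM s hs hd

/-! ### Sylow towers of supersoluble type. -/

/-- The group has a Sylow tower of supersoluble type, and elements of order prime to `p (p - 1)`
act trivially on its `p`-factor. For each prime `p`, `K` is the normal Hall subgroup for the primes
`≥ p` and `L` contains the commutators of `K` with a normal subgroup `C` whose index is divisible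
only by prime divisors of `p (p - 1)`. -/
def HasSupersolubleTypeTower (G : Type*) [Group G] : Prop :=
  ∀ p : ℕ, p.Prime → ∃ K L C : Subgroup G, K.Normal ∧ L.Normal ∧ C.Normal ∧
    (∀ s : ℕ, s.Prime → s ∣ Nat.card K → p ≤ s) ∧ (∀ s : ℕ, s.Prime → s ∣ K.index → s < p) ∧
    (∀ s : ℕ, s.Prime → s ∣ Nat.card L → p < s) ∧ ⁅C, K⁆ ≤ L ∧
    (∀ s : ℕ, s.Prime → s ∣ C.index → s ∣ p * (p - 1))

namespace HasSupersolubleTypeTower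

/-- Here u ∈ K and y ∈ C, so ⁅y, u⁆ lies in U ∩ L. This is trivial, since `U` is a p-group and only
primes greater than p divide the order of `L`. -/
theorem coprimeActionsTrivial {G : Type*} [Group G] (h : HasSupersolubleTypeTower G) :
    CoprimeActionsTrivial G := by
  intro p q hp hq hpq hqp U hU y k hy hyU u hu
  obtain ⟨K, L, C, hK, hL, hC, -, hKi, hLc, hle, hCi⟩ := h p hp
  obtain ⟨j, hj⟩ := exists_pow_prime_pow_eq_one_of_mem hU hu
  have huK : u ∈ K := mem_of_primary_of_not_dvd_index hp (fun hd => (hKi p hp hd).false) hj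
  have hyC : y ∈ C := by
    refine mem_of_primary_of_not_dvd_index hq (fun hd => ?_) hy
    rcases hq.dvd_mul.1 (hCi q hq hd) with hd | hd
    · exact hpq ((Nat.prime_dvd_prime_iff_eq hq hp).1 hd).symm
    · exact hqp hd
  have h1 : ⁅y, u⁆ ∈ L := hle (Subgroup.commutator_mem_commutator hyC huK)
  have h2 : ⁅y, u⁆ ∈ U := by
    rw [commutatorElement_def]
    exact U.mul_mem (hyU u hu) (U.inv_mem hu)
  obtain ⟨l, hl⟩ := exists_pow_prime_pow_eq_one_of_mem hU h2
  by_contra hne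
  exact (hLc p hp (dvd_card_of_primary_mem hp h1 hl
    fun h3 => hne (commutatorElement_eq_one_iff_commute.1 h3))).false

theorem of_injective {G H : Type*} [Group G] [Group H] (h : HasSupersolubleTypeTower G)
    (f : H →* G) (hf : Function.Injective f) : HasSupersolubleTypeTower H := by
  intro p hp
  obtain ⟨K, L, C, hK, hL, hC, hKc, hKi, hLc, hle, hCi⟩ := h p hp
  have card (A : Subgroup G) : Nat.card (A.comap f) ∣ Nat.card A :=
    Subgroup.card_comap_dvd_of_injective A f hf
  have index (A : Subgroup G) (hA : A.Normal) : (A.comap f).index ∣ A.index := by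
    rw [Subgroup.index_comap]
    exact Subgroup.relIndex_dvd_index_of_normal A _
  refine ⟨K.comap f, L.comap f, C.comap f, hK.comap f, hL.comap f, hC.comap f,
    fun s hs hd => hKc s hs (hd.trans (card K)), fun s hs hd => hKi s hs (hd.trans (index K hK)),
    fun s hs hd => hLc s hs (hd.trans (card L)), ?_,
    fun s hs hd => hCi s hs (hd.trans (index C hC))⟩
  rw [Subgroup.commutator_le]
  intro c hc k hk
  rw [Subgroup.mem_comap, map_commutatorElement]
  exact hle (Subgroup.commutator_mem_commutator hc hk)

theorem of_surjective {G H : Type*} [Group G] [Group H] (h : HasSupersolubleTypeTower G)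
    (f : G →* H) (hf : Function.Surjective f) : HasSupersolubleTypeTower H := by
  intro p hp
  obtain ⟨K, L, C, hK, hL, hC, hKc, hKi, hLc, hle, hCi⟩ := h p hp
  have card (A : Subgroup G) : Nat.card (A.map f) ∣ Nat.card A := Subgroup.card_map_dvd A f
  have index (A : Subgroup G) : (A.map f).index ∣ A.index := Subgroup.index_map_dvd A hf
  refine ⟨K.map f, L.map f, C.map f, hK.map f hf, hL.map f hf, hC.map f hf,
    fun s hs hd => hKc s hs (hd.trans (card K)), fun s hs hd => hKi s hs (hd.trans (index K)),
    fun s hs hd => hLc s hs (hd.trans (card L)), ?_,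
    fun s hs hd => hCi s hs (hd.trans (index C))⟩
  rw [← Subgroup.map_commutator]
  exact Subgroup.map_mono hle

theorem of_card_eq_one {G : Type*} [Group G] (h : Nat.card G = 1) :
    HasSupersolubleTypeTower G := by
  have h1 {s : ℕ} (hs : s.Prime) (hd : s ∣ 1) : False := hs.ne_one (Nat.dvd_one.1 hd)
  refine fun p hp => ⟨⊤, ⊥, ⊤, inferInstance, inferInstance, inferInstance, ?_, ?_, ?_, ?_, ?_⟩
  · intro s hs hd
    rw [Subgroup.card_top, h] at hd
    exact (h1 hs hd).elim
  · intro s hs hd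
    rw [Subgroup.index_top] at hd
    exact (h1 hs hd).elim
  · intro s hs hd
    rw [Subgroup.card_bot] at hd
    exact (h1 hs hd).elim
  · have := (Nat.card_eq_one_iff_unique.1 h).1
    exact (Subsingleton.elim _ _).le
  · intro s hs hd
    rw [Subgroup.index_top] at hd
    exact (h1 hs hd).elim

/-- For primes below p the witnesses are pulled back from G/W, which adds only the prime p to
orders. For p itself they are `W`, the trivial subgroup and the centralizer of `W`; for larger
primes `K` and `L` are trivial. -/
theorem of_quotient {G : Type*} [Group G] [Finite G] {p : ℕ} (hp : p.Prime)
    (hmax : ∀ s : ℕ, s.Prime → s ∣ Nat.card G → s ≤ p) (W : Subgroup G) [W.Normal]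
    (hW : IsPGroup p W) (hWi : ¬ p ∣ W.index) (hQ : HasSupersolubleTypeTower (G ⧸ W))
    (hC : ∀ q : ℕ, q.Prime → q ≠ p → ¬ q ∣ p - 1 →
      ¬ q ∣ (Subgroup.centralizer (W : Set G)).index) : HasSupersolubleTypeTower G := by
  intro r hr
  rcases lt_trichotomy r p with hrp | rfl | hrp
  · obtain ⟨K, L, C, hK, hL, hC, hKc, hKi, hLc, hle, hCi⟩ := hQ r hr
    let f := QuotientGroup.mk' W
    have hf : Function.Surjective f := QuotientGroup.mk'_surjective W
    have index (A : Subgroup (G ⧸ W)) : (A.comap f).index = A.index :=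
      A.index_comap_of_surjective hf
    have card (A : Subgroup (G ⧸ W)) {s : ℕ} (hs : s.Prime) (hd : s ∣ Nat.card (A.comap f)) :
        s = p ∨ s ∣ Nat.card A := by
      have h1 : Nat.card (A.comap f) = Nat.card W * Nat.card A := by
        have h2 := (A.comap f).card_mul_index
        have h3 := W.card_mul_index
        have h4 : Nat.card A * A.index = W.index := A.card_mul_index
        rw [index, ← h3, ← h4, ← mul_assoc] at h2
        exact Nat.eq_of_mul_eq_mul_right (Nat.pos_of_ne_zero A.index_ne_zero_of_finite) h2
      rw [h1] at hd
      rcases hs.dvd_mul.1 hd with hd | hd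
      · exact Or.inl (eq_of_prime_dvd_card_of_isPGroup hp hs hW hd)
      · exact Or.inr hd
    refine ⟨K.comap f, L.comap f, C.comap f, hK.comap f, hL.comap f, hC.comap f, ?_, ?_, ?_, ?_,
      ?_⟩
    · intro s hs hd
      rcases card K hs hd with rfl | hd
      · exact hrp.le
      · exact hKc s hs hd
    · intro s hs hd
      exact hKi s hs (index K ▸ hd)
    · intro s hs hd
      rcases card L hs hd with rfl | hd
      · exact hrp
      · exact hLc s hs hd
    · rw [Subgroup.commutator_le]
      intro c hc k hk
      rw [Subgroup.mem_comap, map_commutatorElement]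
      exact hle (Subgroup.commutator_mem_commutator hc hk)
    · intro s hs hd
      exact hCi s hs (index C ▸ hd)
  · refine ⟨W, ⊥, Subgroup.centralizer (W : Set G), inferInstance, inferInstance, inferInstance,
      ?_, ?_, ?_, ?_, ?_⟩
    · intro s hs hd
      exact (eq_of_prime_dvd_card_of_isPGroup hp hs hW hd).ge
    · intro s hs hd
      refine lt_of_le_of_ne (hmax s hs (hd.trans W.index_dvd_card)) ?_
      rintro rfl
      exact hWi hd
    · intro s hs hd
      rw [Subgroup.card_bot] at hd
      exact absurd (Nat.dvd_one.1 hd) hs.ne_one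
    · rw [Subgroup.commutator_comm, le_bot_iff, Subgroup.commutator_eq_bot_iff_le_centralizer,
        Subgroup.le_centralizer_iff]
    · intro s hs hd
      by_contra hsp
      exact hC s hs (fun he => hsp (he ▸ dvd_mul_right s _))
        (fun h => hsp (h.mul_left _)) hd
  · refine ⟨⊥, ⊥, ⊤, inferInstance, inferInstance, inferInstance, ?_, ?_, ?_, ?_, ?_⟩
    · intro s hs hd
      rw [Subgroup.card_bot] at hd
      exact absurd (Nat.dvd_one.1 hd) hs.ne_one
    · intro s hs hd
      rw [Subgroup.index_bot] at hd
      exact (hmax s hs hd).trans_lt hrp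
    · intro s hs hd
      rw [Subgroup.card_bot] at hd
      exact absurd (Nat.dvd_one.1 hd) hs.ne_one
    · rw [Subgroup.commutator_bot_right]
    · intro s hs hd
      rw [Subgroup.index_top] at hd
      exact absurd (Nat.dvd_one.1 hd) hs.ne_one

theorem exists_normal_sylow {G : Type*} [Group G] [Finite G] (h : HasSupersolubleTypeTower G)
    {p : ℕ} (hp : p.Prime) (hmax : ∀ s : ℕ, s.Prime → s ∣ Nat.card G → s ≤ p) :
    ∃ W : Subgroup G, W.Normal ∧ IsPGroup p W ∧ ¬ p ∣ W.index := by
  obtain ⟨K, L, C, hK, hL, hC, hKc, hKi, hLc, hle, hCi⟩ := h p hp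
  exact ⟨K, hK, isPGroup_of_forall_prime_dvd hp fun s hs hd =>
    le_antisymm (hmax s hs (hd.trans K.card_subgroup_dvd_card)) (hKc s hs hd),
    fun hd => (hKi p hp hd).false⟩

end HasSupersolubleTypeTower

theorem Subgroup.normal_map_subtype_of_isPGroup {G : Type*} [Group G] [Finite G] {r : ℕ}
    (hr : r.Prime) {K : Subgroup G} [K.Normal] {R : Subgroup K} [R.Normal] (hR : IsPGroup r R)
    (hRi : ¬ r ∣ R.index) : (R.map K.subtype).Normal := by
  refine ⟨fun x hx g => ?_⟩
  obtain ⟨x, hx, rfl⟩ := hx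
  obtain ⟨k, hk⟩ := exists_pow_prime_pow_eq_one_of_mem hR hx
  have h1 : g * x * g⁻¹ ∈ K := (inferInstance : K.Normal).conj_mem x x.2 g
  refine ⟨⟨_, h1⟩, mem_of_primary_of_not_dvd_index hr hRi (k := k) (Subtype.ext ?_), rfl⟩
  have h2 : (x : G) ^ r ^ k = 1 := by simpa using congrArg Subtype.val hk
  simp [conj_pow, h2]

theorem CoprimeActionsTrivial.not_dvd_index_centralizer {G : Type*} [Group G] [Finite G]
    (h : CoprimeActionsTrivial G) {p q : ℕ} (hp : p.Prime) (hq : q.Prime) (hqp : q ≠ p)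
    (hq1 : ¬ q ∣ p - 1) {W : Subgroup G} [W.Normal] (hW : IsPGroup p W) :
    ¬ q ∣ (Subgroup.centralizer (W : Set G)).index := by
  refine not_dvd_index_of_primary_mem hq fun y k hy => ?_
  rw [Subgroup.mem_centralizer_iff]
  exact fun w hw => (h p q hp hq hqp.symm hq1 W hW y k hy
    (fun u hu => (inferInstance : W.Normal).conj_mem u hu y) w hw).symm

/-- A prime exceeding the smallest prime divisor p cannot divide p - 1, so Frobenius' theorem gives
a normal p-complement `K`. If the largest prime r differs from p, the normal Sylow r-subgroup of
`K`, given by induction, is a normal Sylow subgroup of G. -/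
theorem CoprimeActionsTrivial.hasSupersolubleTypeTower {G : Type*} [Group G] [Finite G]
    (h : CoprimeActionsTrivial G) : HasSupersolubleTypeTower G := by
  induction hn : Nat.card G using Nat.strong_induction_on generalizing G with
  | _ n ih =>
  by_cases h1 : Nat.card G = 1
  · exact .of_card_eq_one h1
  have h0 : Nat.card G ≠ 0 := Nat.card_pos.ne'
  let p := (Nat.card G).minFac
  have hp : p.Prime := Nat.minFac_prime h1
  have hpG : p ∣ Nat.card G := Nat.minFac_dvd _
  have hfact := Fact.mk hp
  obtain ⟨r, hr⟩ : ∃ r, Maximal (· ∈ (Nat.card G).primeFactors) r :=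
    Finset.exists_maximal ⟨p, Nat.mem_primeFactors.2 ⟨hp, hpG, h0⟩⟩
  have hrp : r.Prime := Nat.prime_of_mem_primeFactors hr.1
  have hrG : r ∣ Nat.card G := Nat.dvd_of_mem_primeFactors hr.1
  have hmax : ∀ s : ℕ, s.Prime → s ∣ Nat.card G → s ≤ r := fun s hs hd =>
    (le_total s r).elim id fun hle => hr.2 (Nat.mem_primeFactors.2 ⟨hs, hd, h0⟩) hle
  suffices H : ∃ W : Subgroup G, W.Normal ∧ IsPGroup r W ∧ ¬ r ∣ W.index by
    obtain ⟨W, hWn, hW, hWi⟩ := H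
    refine .of_quotient hrp hmax W hW hWi ?_ fun q hq hqr hq1 =>
      h.not_dvd_index_centralizer hrp hq hqr hq1 hW
    have hrW : r ∣ Nat.card W := by
      rw [← W.card_mul_index] at hrG
      exact (hrp.dvd_mul.1 hrG).resolve_right hWi
    have hcop : Nat.Coprime (Nat.card W) W.index := by
      have := Fact.mk hrp
      obtain ⟨m, hm⟩ := IsPGroup.iff_card.1 hW
      rw [hm]
      exact Nat.Coprime.pow_left m ((Nat.Prime.coprime_iff_not_dvd hrp).2 hWi)
    -- The coprime condition is inherited by subgroups but not evidently by quotients, so G/W is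
    -- replaced by a complement of `W`.
    obtain ⟨H, hH⟩ := Subgroup.exists_right_complement'_of_coprime hcop
    have hlt : Nat.card H < n := by
      rw [← hn, ← hH.card_mul_card]
      have h2 : 1 < Nat.card W := lt_of_lt_of_le hrp.one_lt (Nat.le_of_dvd Nat.card_pos hrW)
      have h3 : 0 < Nat.card H := Nat.card_pos
      nlinarith
    exact (ih _ hlt (h.subgroup H) rfl).of_injective
      (hH.symm.QuotientMulEquiv).toMonoidHom (hH.symm.QuotientMulEquiv).injective
  by_cases hpr : r = p
  · refine ⟨⊤, inferInstance, ?_, ?_⟩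
    · refine isPGroup_of_forall_prime_dvd hrp fun s hs hd => ?_
      rw [Subgroup.card_top] at hd
      exact le_antisymm (hmax s hs hd) (hpr ▸ Nat.minFac_le_of_dvd hs.two_le hd)
    · rw [Subgroup.index_top]
      exact fun hd => hrp.ne_one (Nat.dvd_one.1 hd)
  have hF : FrobeniusCondition p G := by
    intro U hU q hq hqp y k hy hyU u hu
    by_cases hy1 : y = 1
    · rw [hy1]
      exact Commute.one_left u
    have hqG : q ∣ Nat.card G := by
      have := dvd_card_of_primary_mem hq (Subgroup.mem_top y) hy hy1
      rwa [Subgroup.card_top] at this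
    have hle : p ≤ q := Nat.minFac_le_of_dvd hq.two_le hqG
    refine h p q hp hq (Ne.symm hqp) (fun hd => ?_) U hU y k hy hyU u hu
    have := Nat.le_of_dvd (Nat.sub_pos_of_lt hp.one_lt) hd
    omega
  obtain ⟨K, hK, hpK, hKi⟩ := hF.exists_normal_complement
  have hKlt : Nat.card K < n := by
    rw [← hn]
    refine lt_of_le_of_ne K.card_le_card_group fun he => hpK ?_
    rwa [he]
  obtain ⟨R, hRn, hR, hRi⟩ := (ih _ hKlt (h.subgroup K) rfl).exists_normal_sylow hrp
    fun s hs hd => hmax s hs (hd.trans K.card_subgroup_dvd_card)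
  refine ⟨R.map K.subtype, Subgroup.normal_map_subtype_of_isPGroup hrp hR hRi, hR.map _, ?_⟩
  rw [Subgroup.index_map_subtype]
  exact fun hd => (hrp.dvd_mul.1 hd).elim hRi fun hd => hpr (hKi r hrp hd)

/-! ### Permuting subgroups. -/

namespace SubgroupsPermute

variable {G : Type*} [Group G] {A B : Subgroup G}

theorem symm (h : SubgroupsPermute A B) : SubgroupsPermute B A :=
  Eq.symm h

theorem coe_sup (h : SubgroupsPermute A B) :
    ((A ⊔ B : Subgroup G) : Set G) = (A : Set G) * (B : Set G) := by
  let M : Subgroup G :=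
    { carrier := (A : Set G) * (B : Set G)
      one_mem' := ⟨1, A.one_mem, 1, B.one_mem, mul_one 1⟩
      mul_mem' := by
        rintro _ _ ⟨a, ha, b, hb, rfl⟩ ⟨a', ha', b', hb', rfl⟩
        have h1 : b * a' ∈ (A : Set G) * (B : Set G) := h.symm ▸ Set.mul_mem_mul hb ha'
        obtain ⟨a'', ha'', b'', hb'', h2⟩ := h1
        refine ⟨a * a'', A.mul_mem ha ha'', b'' * b', B.mul_mem hb'' hb', ?_⟩
        simp only at h2 ⊢
        rw [mul_assoc a a'', ← mul_assoc a'', h2]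
        group
      inv_mem' := by
        rintro _ ⟨a, ha, b, hb, rfl⟩
        simp only [mul_inv_rev]
        exact h.symm ▸ Set.mul_mem_mul (B.inv_mem hb) (A.inv_mem ha) }
  have hM : A ⊔ B = M := by
    refine le_antisymm (sup_le (fun a ha => ⟨a, ha, 1, B.one_mem, mul_one a⟩)
      fun b hb => ⟨1, A.one_mem, b, hb, one_mul b⟩) ?_
    rintro _ ⟨a, ha, b, hb, rfl⟩
    exact (A ⊔ B).mul_mem (Subgroup.mem_sup_left ha) (Subgroup.mem_sup_right hb)
  rw [hM]
  rfl

theorem exists_mul_eq_of_mem_sup (h : SubgroupsPermute A B) {x : G} (hx : x ∈ A ⊔ B) :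
    ∃ a ∈ A, ∃ b ∈ B, a * b = x := by
  rw [← SetLike.mem_coe, h.coe_sup] at hx
  exact hx

theorem of_mul_mem (h : ∀ b ∈ B, ∀ a ∈ A, b * a ∈ (A : Set G) * (B : Set G)) :
    SubgroupsPermute A B := by
  refine Set.Subset.antisymm ?_ ?_
  · rintro _ ⟨a, ha, b, hb, rfl⟩
    obtain ⟨a', ha', b', hb', h1⟩ := h _ (B.inv_mem hb) _ (A.inv_mem ha)
    refine ⟨b'⁻¹, B.inv_mem hb', a'⁻¹, A.inv_mem ha', ?_⟩
    simp only at h1 ⊢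
    rw [← mul_inv_rev, h1, mul_inv_rev, inv_inv, inv_inv]
  · rintro _ ⟨b, hb, a, ha, rfl⟩
    exact h b hb a ha

/-- `A` acts transitively on the cosets of `B` in AB. -/
theorem relIndex_sup_dvd (h : SubgroupsPermute A B) : B.relIndex (A ⊔ B) ∣ Nat.card A := by
  let T := A ⊔ B
  have huniv : MulAction.orbit (A.subgroupOf T) ((1 : T) : T ⧸ B.subgroupOf T) = Set.univ := by
    refine Set.eq_univ_of_forall fun x => ?_
    obtain ⟨t, rfl⟩ := QuotientGroup.mk_surjective x
    obtain ⟨a, ha, b, hb, hab⟩ := h.exists_mul_eq_of_mem_sup t.2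
    refine ⟨⟨⟨a, Subgroup.mem_sup_left ha⟩, ha⟩, QuotientGroup.eq.2 ?_⟩
    have : a⁻¹ * (t : G) = b := by rw [← hab, inv_mul_cancel_left]
    simpa [Subgroup.mem_subgroupOf, this] using hb
  have h1 := MulAction.index_stabilizer (A.subgroupOf T) ((1 : T) : T ⧸ B.subgroupOf T)
  rw [huniv, Set.ncard_univ] at h1
  rw [Subgroup.relIndex, Subgroup.index, ← h1,
    ← Nat.card_congr (Subgroup.subgroupOfEquivOfLe (le_sup_left : A ≤ T)).toEquiv]
  exact Subgroup.index_dvd_card _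

theorem dvd_card_or_dvd_card_of_dvd_card_sup (h : SubgroupsPermute A B) {s : ℕ} (hs : s.Prime)
    (hd : s ∣ Nat.card (A ⊔ B : Subgroup G)) : s ∣ Nat.card A ∨ s ∣ Nat.card B := by
  rw [← (B.subgroupOf (A ⊔ B)).card_mul_index,
    Nat.card_congr (Subgroup.subgroupOfEquivOfLe (le_sup_right : B ≤ A ⊔ B)).toEquiv] at hd
  exact ((hs.dvd_mul.1 hd).imp_right fun hd => hd.trans h.relIndex_sup_dvd).symm

end SubgroupsPermute

/-! ### Normal Sylow subgroups of two mutually permutable subgroups. -/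

theorem MutuallyPermutable.symm {G : Type*} [Group G] {A B : Subgroup G}
    (h : MutuallyPermutable A B) : MutuallyPermutable B A :=
  ⟨h.2, h.1⟩

/-- `P` is a Sylow `p`-subgroup of `A` that is normal in `A`. -/
structure IsNormalSylow {G : Type*} [Group G] (p : ℕ) (A P : Subgroup G) : Prop where
  le : P ≤ A
  isPGroup : IsPGroup p P
  conj_mem : ∀ a ∈ A, ∀ x ∈ P, a * x * a⁻¹ ∈ P
  mem_of_primary : ∀ x ∈ A, ∀ k : ℕ, x ^ p ^ k = 1 → x ∈ P

theorem HasSupersolubleTypeTower.exists_isNormalSylow {G : Type*} [Group G] [Finite G]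
    {A : Subgroup G} (h : HasSupersolubleTypeTower A) {p : ℕ} (hp : p.Prime)
    (hmax : ∀ s : ℕ, s.Prime → s ∣ Nat.card A → s ≤ p) :
    ∃ P : Subgroup G, IsNormalSylow p A P := by
  obtain ⟨W, hWn, hW, hWi⟩ := h.exists_normal_sylow hp hmax
  refine ⟨W.map A.subtype, Subgroup.map_subtype_le W, hW.map _, ?_, fun x hx k hk => ?_⟩
  · rintro a ha _ ⟨x, hx, rfl⟩
    exact ⟨_, hWn.conj_mem x hx ⟨a, ha⟩, rfl⟩
  · exact ⟨⟨x, hx⟩, mem_of_primary_of_not_dvd_index hp hWi (k := k) (Subtype.ext (by simpa using hk)),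
      rfl⟩

/-- The q-group ⟨a⟩ acts on `Y` by conjugation, with the elements commuting with `a` as fixed
points. -/
theorem card_modEq_card_inf_centralizer {G : Type*} [Group G] [Finite G] {q k : ℕ} (hq : q.Prime)
    {Y : Subgroup G} {a : G} (ha : a ^ q ^ k = 1) (haY : ∀ y ∈ Y, a * y * a⁻¹ ∈ Y) :
    Nat.card Y ≡ Nat.card (Y ⊓ Subgroup.centralizer {a} : Subgroup G) [MOD q] := by
  have hqf := Fact.mk hq
  have hN : Subgroup.zpowers a ≤ Subgroup.normalizer (Y : Set G) := by
    rw [Subgroup.zpowers_le]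
    exact Subgroup.mem_normalizer_fintype haY
  let ψ : Subgroup.zpowers a →* MulAut Y := Y.normalizerMonoidHom.comp (Subgroup.inclusion hN)
  let _ : MulAction (Subgroup.zpowers a) Y := MulAction.compHom Y ψ
  have hsmul : ∀ (g : Subgroup.zpowers a) (y : Y), ((g • y : Y) : G) = g * y * (g : G)⁻¹ :=
    fun g y => rfl
  refine ((isPGroup_zpowers_of_pow_eq_one ha).card_modEq_card_fixedPoints Y).trans ?_
  have e : MulAction.fixedPoints (Subgroup.zpowers a) Y ≃
      (Y ⊓ Subgroup.centralizer {a} : Subgroup G) :=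
    { toFun := fun y => ⟨y.1, y.1.2, by
        have h1 := congrArg Subtype.val (y.2 ⟨a, Subgroup.mem_zpowers a⟩)
        rw [hsmul] at h1
        exact Subgroup.mem_centralizer_singleton_iff.2 (mul_inv_eq_iff_eq_mul.1 h1).symm⟩
      invFun := fun y => ⟨⟨y.1, y.2.1⟩, fun g => Subtype.ext (by
        obtain ⟨i, hi⟩ := Subgroup.mem_zpowers_iff.1 g.2
        have h1 : Commute a y :=
          (Subgroup.mem_centralizer_singleton_iff.1 y.2.2).symm
        rw [hsmul, ← hi]
        exact mul_inv_eq_iff_eq_mul.2 (h1.zpow_left i))⟩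
      left_inv := fun _ => rfl
      right_inv := fun _ => rfl }
  rw [Nat.card_congr e]

namespace MutuallyPermutable

variable {G : Type*} [Group G] [Finite G] {A B P Q : Subgroup G} {p q : ℕ}

theorem permute_normalSylow (hAB : MutuallyPermutable A B) [hp : Fact p.Prime]
    (hP : IsNormalSylow p A P) (hQ : IsNormalSylow p B Q) : SubgroupsPermute P Q := by
  have hAQ : SubgroupsPermute A Q := hAB.1 Q hQ.le
  have hPB : SubgroupsPermute P B := (hAB.2 P hP.le).symm
  -- Elements of PB ∩ AQ factor through P, A ∩ B and Q. The middle factor normalizes both `P` and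
  -- `Q`, which makes the Sylow argument in `L` work.
  let L : Subgroup G := (P ⊔ B) ⊓ (A ⊔ Q)
  have hPL : P ≤ L := le_inf le_sup_left (hP.le.trans le_sup_left)
  have hQL : Q ≤ L := le_inf (hQ.le.trans le_sup_right) le_sup_right
  have factor : ∀ z ∈ L, ∃ u ∈ P, ∃ d ∈ A ⊓ B, ∃ v ∈ Q, z = u * d * v := by
    rintro z ⟨hz₁, hz₂⟩
    obtain ⟨u, hu, b, hb, rfl⟩ := hPB.exists_mul_eq_of_mem_sup hz₁
    obtain ⟨a, ha, v, hv, hav⟩ := hAQ.exists_mul_eq_of_mem_sup hz₂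
    have hd : b * v⁻¹ = u⁻¹ * a := by
      rw [mul_inv_eq_iff_eq_mul, mul_assoc, hav, inv_mul_cancel_left]
    refine ⟨u, hu, b * v⁻¹, ⟨?_, B.mul_mem hb (B.inv_mem (hQ.le hv))⟩, v, hv, by group⟩
    rw [hd]
    exact A.mul_mem (A.inv_mem (hP.le hu)) ha
  obtain ⟨S, hS⟩ := (hP.isPGroup.comap_subtype (K := L)).exists_le_sylow
  obtain ⟨T, hT⟩ := (hQ.isPGroup.comap_subtype (K := L)).exists_le_sylow
  obtain ⟨g, hg⟩ := MulAction.exists_smul_eq L S T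
  -- A Sylow subgroup of `L` containing `P` also contains `Q`: a conjugating element splits into a
  -- part in `B`, normalizing `Q`, and a part in `P`.
  have hQS : ∀ y (hy : y ∈ Q), (⟨y, hQL hy⟩ : L) ∈ S.toSubgroup := by
    intro y hy
    obtain ⟨u, hu, d, hd, v, hv, hgi⟩ := factor (g : G)⁻¹ (L.inv_mem g.2)
    have hg' : (g : G) = v⁻¹ * d⁻¹ * u⁻¹ := by rw [← inv_inv (g : G), hgi]; group
    have hb : v⁻¹ * d⁻¹ ∈ B := B.mul_mem (B.inv_mem (hQ.le hv)) (B.inv_mem hd.2)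
    have hw := hQ.conj_mem _ hb y hy
    have hwT : (⟨_, hQL hw⟩ : L) ∈ T.toSubgroup := hT hw
    rw [← hg, Sylow.mem_smul_iff] at hwT
    have huS : (⟨u, hPL hu⟩ : L) ∈ S.toSubgroup := hS hu
    have := S.toSubgroup.mul_mem (S.toSubgroup.mul_mem (S.toSubgroup.inv_mem huS) hwT) huS
    convert this using 1
    refine Subtype.ext ?_
    simp only [Subgroup.coe_mul, Subgroup.coe_inv, hg']
    group
  refine SubgroupsPermute.of_mul_mem fun y hy x hx => ?_
  have hxS : (⟨x, hPL hx⟩ : L) ∈ S.toSubgroup := hS hx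
  obtain ⟨u, hu, d, hd, v, hv, h1⟩ := factor (y * x) (L.mul_mem (hQL hy) (hPL hx))
  have huS : (⟨u, hPL hu⟩ : L) ∈ S.toSubgroup := hS hu
  have hd' : d = u⁻¹ * (y * x) * v⁻¹ := by rw [h1]; group
  have hdL : d ∈ L := hd' ▸
    L.mul_mem (L.mul_mem (L.inv_mem (hPL hu)) (L.mul_mem (hQL hy) (hPL hx))) (L.inv_mem (hQL hv))
  have hdS : (⟨d, hdL⟩ : L) ∈ S.toSubgroup := by
    have := S.toSubgroup.mul_mem (S.toSubgroup.mul_mem (S.toSubgroup.inv_mem huS)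
      (S.toSubgroup.mul_mem (hQS y hy) hxS)) (S.toSubgroup.inv_mem (hQS v hv))
    convert this using 1
    exact Subtype.ext (by simpa using hd')
  obtain ⟨k, hk⟩ := exists_pow_prime_pow_eq_one_of_mem S.isPGroup' hdS
  -- The middle factor of `y * x` is a p-element of `A`, hence is absorbed by `P`.
  have hdP : d ∈ P := hP.mem_of_primary d hd.1 k (by simpa using congrArg Subtype.val hk)
  exact ⟨u * d, P.mul_mem hu hdP, v, hv, h1.symm⟩

/-- A `q`-element of `A` normalizes a normal Sylow `p`-subgroup of `B` if `q < p`. -/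
theorem conj_mem_normalSylow (hAB : MutuallyPermutable A B) (hp : p.Prime) (hq : q.Prime)
    (hqp : q < p) (hQ : IsNormalSylow p B Q) {a : G} (ha : a ∈ A) {k : ℕ} (hak : a ^ q ^ k = 1) :
    ∀ x ∈ Q, a * x * a⁻¹ ∈ Q := by
  induction k generalizing a with
  | zero =>
    intro x hx
    rw [pow_zero, pow_one] at hak
    simpa [hak] using hx
  | succ k ih =>
    have hpf := Fact.mk hp
    have hqf := Fact.mk hq
    have haq := ih (A.pow_mem ha q) (by rw [← pow_mul, ← pow_succ', hak])
    have hperm : SubgroupsPermute (Subgroup.zpowers a) B :=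
      (hAB.2 _ (by rwa [Subgroup.zpowers_le])).symm
    let T := Subgroup.zpowers a ⊔ B
    have hBT : B ≤ T := le_sup_right
    have haT : a ∈ T := Subgroup.mem_sup_left (Subgroup.mem_zpowers a)
    let a' : T := ⟨a, haT⟩
    have fact : ∀ t : T, ∃ i : ℕ, ∃ b : T, (b : G) ∈ B ∧ t = a' ^ i * b := by
      intro t
      obtain ⟨c, hc, b, hb, hcb⟩ := hperm.exists_mul_eq_of_mem_sup t.2
      obtain ⟨i, rfl⟩ := mem_powers_iff_mem_zpowers.2 hc
      exact ⟨i, ⟨b, hBT hb⟩, hb, Subtype.ext hcb.symm⟩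
    have hBi : ¬ p ∣ (B.subgroupOf T).index := by
      intro hd
      exact hqp.ne' (eq_of_prime_dvd_card_of_isPGroup hq hp (isPGroup_zpowers_of_pow_eq_one hak)
        (hd.trans hperm.relIndex_sup_dvd))
    have hQi : ¬ p ∣ (Q.subgroupOf T).index := by
      have h1 : (Q.subgroupOf T).index = Q.relIndex B * (B.subgroupOf T).index :=
        (Subgroup.relIndex_mul_relIndex Q B T hQ.le hBT).symm
      rw [h1]
      refine fun hd => (hp.dvd_mul.1 hd).elim ?_ hBi
      exact not_dvd_index_of_primary_mem hp fun x k hx =>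
        hQ.mem_of_primary x x.2 k (by simpa using congrArg Subtype.val hx)
    let S : Sylow p T := (hQ.isPGroup.comap_subtype (K := T)).toSylow hQi
    have hmem : ∀ t : T, t ∈ S.toSubgroup ↔ (t : G) ∈ Q := fun t => Iff.rfl
    have hBS : ∀ b : T, (b : G) ∈ B → b • S = S := by
      intro b hb
      refine Sylow.smul_eq_iff_mem_normalizer.2 (Subgroup.mem_normalizer_fintype fun x hx => ?_)
      exact hQ.conj_mem b hb x hx
    have haS : (a' ^ q) • S = S := by
      refine Sylow.smul_eq_iff_mem_normalizer.2 (Subgroup.mem_normalizer_fintype fun x hx => ?_)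
      exact haq x hx
    -- Both `B` and a^q normalize `Q`, so its conjugates in ⟨a⟩B come from a^i with i < q. Fewer
    -- than p + 1 Sylow p-subgroups means exactly one.
    have hcard : Nat.card (Sylow p T) ≤ q := by
      have hsurj : Function.Surjective fun i : Fin q => a' ^ (i : ℕ) • S := by
        intro R
        obtain ⟨t, rfl⟩ := MulAction.exists_smul_eq T S R
        obtain ⟨i, b, hb, rfl⟩ := fact t
        refine ⟨⟨i % q, Nat.mod_lt _ hq.pos⟩, ?_⟩
        have h1 : ∀ n : ℕ, (a' ^ q) ^ n • S = S := by
          intro n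
          induction n with
          | zero => rw [pow_zero, one_smul]
          | succ n ihn => rw [pow_succ, mul_smul, haS, ihn]
        simp only
        rw [mul_smul, hBS b hb]
        conv_rhs => rw [← Nat.mod_add_div i q, pow_add, pow_mul, mul_smul, h1]
      simpa using Nat.card_le_card_of_surjective _ hsurj
    have hone : Nat.card (Sylow p T) = 1 :=
      (card_sylow_modEq_one p T).eq_of_lt_of_lt (hcard.trans_lt hqp) hp.one_lt
    have hsub := (Nat.card_eq_one_iff_unique.1 hone).1
    intro x hx
    have hxS : (⟨x, hBT (hQ.le hx)⟩ : T) ∈ S.toSubgroup := hx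
    have h1 : a' • S = S := Subsingleton.elim _ _
    exact (Subgroup.mem_normalizer_iff.1 (Sylow.smul_eq_iff_mem_normalizer.1 h1) _).1 hxS

/-- A `q`-element of `A` centralizing a normal Sylow `p`-subgroup of `A` and normalizing a normal
Sylow `p`-subgroup of `B` centralizes the latter if `q` does not divide `p - 1`. -/
theorem commute_normalSylow (hAB : MutuallyPermutable A B) (hp : p.Prime) (hq : q.Prime)
    (hpq : p ≠ q) (hqp : ¬ q ∣ p - 1) (hP : IsNormalSylow p A P) (hQ : IsNormalSylow p B Q)
    {a : G} (ha : a ∈ A) {k : ℕ} (hak : a ^ q ^ k = 1) (haP : ∀ x ∈ P, Commute a x)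
    (haQ : ∀ x ∈ Q, a * x * a⁻¹ ∈ Q) : ∀ y ∈ Q, Commute a y := by
  have hpf := Fact.mk hp
  suffices H : ∀ (j : ℕ) (y : G), y ∈ Q → y ^ p ^ j = 1 → Commute a y by
    intro y hy
    obtain ⟨j, hj⟩ := exists_pow_prime_pow_eq_one_of_mem hQ.isPGroup hy
    exact H j y hy hj
  intro j
  induction j with
  | zero =>
    intro y _ hy
    rw [pow_zero, pow_one] at hy
    rw [hy]
    exact Commute.one_right a
  | succ j ih =>
    intro y hy hyj
    by_contra hay
    have hyp : Commute a (y ^ p) := ih _ (Q.pow_mem hy p) (by rw [← pow_mul, ← pow_succ', hyj])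
    have hyQ : Subgroup.zpowers y ≤ Q := by rwa [Subgroup.zpowers_le]
    have hperm : SubgroupsPermute A (Subgroup.zpowers y) := hAB.1 _ (hyQ.trans hQ.le)
    -- Elements of `Y` have the form y^i d with d ∈ A ∩ Q ≤ P, so `d` commutes with `a`, as does y^p
    -- by induction. Hence C_Y(a) has index at most p in `Y`, so exactly p; then q divides |Y| -
    -- |C_Y(a)| = |C_Y(a)|(p - 1), which is impossible.
    let Y : Subgroup G := Q ⊓ (A ⊔ Subgroup.zpowers y)
    have hyY : y ∈ Y := ⟨hy, Subgroup.mem_sup_right (Subgroup.mem_zpowers y)⟩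
    have haY : ∀ z ∈ Y, a * z * a⁻¹ ∈ Y := fun z hz =>
      ⟨haQ z hz.1, Subgroup.mul_mem _ (Subgroup.mul_mem _ (Subgroup.mem_sup_left ha) hz.2)
        (Subgroup.inv_mem _ (Subgroup.mem_sup_left ha))⟩
    have fact : ∀ z ∈ Y, ∃ d : G, Commute a d ∧ ∃ i : ℕ, z = y ^ i * d := by
      intro z hz
      obtain ⟨c, hc, d, hd, hcd⟩ := hperm.symm.exists_mul_eq_of_mem_sup (sup_comm A _ ▸ hz.2)
      have hdQ : d ∈ Q := by
        have : d = c⁻¹ * z := by rw [← hcd]; group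
        exact this ▸ Q.mul_mem (Q.inv_mem (hyQ hc)) hz.1
      obtain ⟨i, rfl⟩ := mem_powers_iff_mem_zpowers.2 hc
      obtain ⟨l, hl⟩ := exists_pow_prime_pow_eq_one_of_mem hQ.isPGroup hdQ
      exact ⟨d, haP d (hP.mem_of_primary d hd l hl), i, hcd.symm⟩
    let C : Subgroup G := Y ⊓ Subgroup.centralizer {a}
    have hCY : C ≤ Y := inf_le_left
    have memC : ∀ z ∈ Y, Commute a z → z ∈ C := fun z hz h =>
      ⟨hz, Subgroup.mem_centralizer_singleton_iff.2 h.symm⟩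
    have hYp : IsPGroup p Y := hQ.isPGroup.to_le inf_le_left
    have hle : (C.subgroupOf Y).index ≤ p := by
      have hsurj : Function.Surjective fun i : Fin p =>
          (((⟨y, hyY⟩ : Y) ^ (i : ℕ) : Y) : Y ⧸ C.subgroupOf Y) := by
        intro x
        obtain ⟨z, rfl⟩ := QuotientGroup.mk_surjective x
        obtain ⟨d, hd, i, hi⟩ := fact z z.2
        refine ⟨⟨i % p, Nat.mod_lt _ hp.pos⟩, ?_⟩
        refine QuotientGroup.eq.2
          (memC _ (((⟨y, hyY⟩ : Y) ^ (i % p))⁻¹ * z : Y).2 ?_)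
        have h1 : (y ^ (i % p))⁻¹ * (z : G) = (y ^ p) ^ (i / p) * d := by
          rw [hi, inv_mul_eq_iff_eq_mul, ← mul_assoc, ← pow_mul, ← pow_add, Nat.mod_add_div]
        have h2 : Commute a ((y ^ p) ^ (i / p) * d) := (hyp.pow_right _).mul_right hd
        rw [← h1] at h2
        simpa using h2
      rw [Subgroup.index]
      simpa using Nat.card_le_card_of_surjective _ hsurj
    obtain ⟨n, hn⟩ := hYp.index (C.subgroupOf Y)
    have hidx : (C.subgroupOf Y).index = p := by
      rcases Nat.lt_trichotomy n 1 with h | h | h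
      · have h0 : n = 0 := by omega
        rw [h0, pow_zero, Subgroup.index_eq_one, Subgroup.subgroupOf_eq_top] at hn
        exact absurd (Subgroup.mem_centralizer_singleton_iff.1 (hn hyY).2).symm hay
      · rw [hn, h, pow_one]
      · rw [hn] at hle
        have := Nat.pow_lt_pow_right hp.one_lt h
        rw [pow_one] at this
        omega
    have hcard : Nat.card Y = Nat.card C * p := by
      have := (C.subgroupOf Y).card_mul_index
      rw [hidx, Nat.card_congr (Subgroup.subgroupOfEquivOfLe hCY).toEquiv] at this
      exact this.symm
    have hmod := card_modEq_card_inf_centralizer hq hak haY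
    have hd : q ∣ Nat.card C * (p - 1) := by
      rw [Nat.mul_sub, mul_one, ← hcard]
      exact (Nat.modEq_iff_dvd' (Subgroup.card_le_of_le hCY)).1 hmod.symm
    rcases hq.dvd_mul.1 hd with hd | hd
    · exact hpq (eq_of_prime_dvd_card_of_isPGroup hp hq (hYp.to_le hCY) hd).symm
    · exact hqp hd

end MutuallyPermutable

/-! ### Products of several pairwise permuting subgroups. -/

section PermutableProducts

variable {G : Type*} [Group G]

theorem coe_iSup_list_eq_prod (l : List (Subgroup G))
    (h : ∀ A ∈ l, ∀ B ∈ l, SubgroupsPermute A B) :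
    ((⨆ A ∈ l, A : Subgroup G) : Set G) = (l.map fun A : Subgroup G => (A : Set G)).prod ∧
      ∀ s : ℕ, s.Prime → s ∣ Nat.card (⨆ A ∈ l, A : Subgroup G) → ∃ A ∈ l, s ∣ Nat.card A := by
  induction l with
  | nil =>
    refine ⟨by simp [Set.singleton_one], fun s hs hd => ?_⟩
    simp only [List.not_mem_nil, iSup_false, iSup_bot, Subgroup.card_bot, Nat.dvd_one] at hd
    exact absurd hd hs.ne_one
  | cons A l ih =>
    obtain ⟨ih₁, ih₂⟩ := ih fun B hB C hC =>
      h B (List.mem_cons_of_mem A hB) C (List.mem_cons_of_mem A hC)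
    have hsup : (⨆ B ∈ A :: l, B : Subgroup G) = A ⊔ ⨆ B ∈ l, B := by
      simp [iSup_or, iSup_sup_eq]
    have hperm : SubgroupsPermute A (⨆ B ∈ l, B) := by
      rw [SubgroupsPermute, ih₁]
      refine Commute.list_prod_right _ (A : Set G) fun X hX => ?_
      obtain ⟨B, hB, rfl⟩ := List.mem_map.1 hX
      exact h A List.mem_cons_self B (List.mem_cons_of_mem A hB)
    rw [hsup]
    refine ⟨by rw [hperm.coe_sup, ih₁, List.map_cons, List.prod_cons], fun s hs hd => ?_⟩
    rcases hperm.dvd_card_or_dvd_card_of_dvd_card_sup hs hd with hd | hd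
    · exact ⟨A, List.mem_cons_self, hd⟩
    · obtain ⟨B, hB, hd⟩ := ih₂ s hs hd
      exact ⟨B, List.mem_cons_of_mem A hB, hd⟩

theorem coe_iSup_eq_prod {n : ℕ} (H : Fin n → Subgroup G)
    (h : ∀ i j, SubgroupsPermute (H i) (H j)) :
    ((⨆ i, H i : Subgroup G) : Set G) = (List.ofFn fun i => (H i : Set G)).prod ∧
      ∀ s : ℕ, s.Prime → s ∣ Nat.card (⨆ i, H i : Subgroup G) → ∃ i, s ∣ Nat.card (H i) := by
  have hsup : (⨆ A ∈ List.ofFn H, A : Subgroup G) = ⨆ i, H i := by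
    refine le_antisymm (iSup₂_le fun A hA => ?_) (iSup_le fun i =>
      le_iSup₂_of_le (H i) (List.mem_ofFn.2 ⟨i, rfl⟩) le_rfl)
    obtain ⟨i, rfl⟩ := List.mem_ofFn.1 hA
    exact le_iSup H i
  obtain ⟨h₁, h₂⟩ := coe_iSup_list_eq_prod (List.ofFn H) (by
    simp only [List.mem_ofFn]
    rintro _ ⟨i, rfl⟩ _ ⟨j, rfl⟩
    exact h i j)
  rw [hsup] at h₁ h₂
  refine ⟨by rw [h₁, List.map_ofFn]; rfl, fun s hs hd => ?_⟩
  obtain ⟨A, hA, hd⟩ := h₂ s hs hd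
  obtain ⟨i, rfl⟩ := List.mem_ofFn.1 hA
  exact ⟨i, hd⟩

theorem SubgroupsPermute.map {K : Type*} [Group K] {A B : Subgroup G} (h : SubgroupsPermute A B)
    (f : G →* K) : SubgroupsPermute (A.map f) (B.map f) := by
  rw [SubgroupsPermute, Subgroup.coe_map, Subgroup.coe_map, ← Set.image_mul, ← Set.image_mul,
    show (A : Set G) * B = B * A from h]

theorem MutuallyPermutable.map {K : Type*} [Group K] {A B : Subgroup G}
    (h : MutuallyPermutable A B) (f : G →* K) : MutuallyPermutable (A.map f) (B.map f) := by
  have lift {B : Subgroup G} {U : Subgroup K} (hU : U ≤ B.map f) : (U.comap f ⊓ B).map f = U := by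
    refine le_antisymm ?_ fun x hx => ?_
    · rintro _ ⟨x, hx, rfl⟩
      exact hx.1
    · obtain ⟨b, hb, rfl⟩ := hU hx
      exact ⟨b, ⟨hx, hb⟩, rfl⟩
  refine ⟨fun U hU => ?_, fun V hV => ?_⟩
  · rw [← lift hU]
    exact (h.1 _ inf_le_right).map f
  · rw [← lift hV]
    exact (h.2 _ inf_le_right).map f

namespace IsPairwiseMutuallyPermutableProduct

variable {n : ℕ} {H : Fin n → Subgroup G}

theorem permute (h : IsPairwiseMutuallyPermutableProduct H) (i j : Fin n) :
    SubgroupsPermute (H i) (H j) := by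
  by_cases hij : i = j
  · subst hij
    exact rfl
  · exact (h.2 i j hij).1 _ le_rfl

theorem iSup_eq_top (h : IsPairwiseMutuallyPermutableProduct H) : ⨆ i, H i = ⊤ := by
  have h1 := (coe_iSup_eq_prod H h.permute).1
  rw [h.1] at h1
  exact SetLike.coe_injective h1

theorem map (h : IsPairwiseMutuallyPermutableProduct H) {K : Type*} [Group K] (f : G →* K)
    (hf : Function.Surjective f) :
    IsPairwiseMutuallyPermutableProduct fun i => (H i).map f := by
  refine ⟨?_, fun i j hij => (h.2 i j hij).map f⟩
  have h1 := congrArg (fun s => f '' s) h.1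
  simp only [Set.image_list_prod, Set.image_univ, List.map_ofFn, hf.range_eq] at h1
  exact h1

/-- If q divided the order of G/N, it would divide the order of the image of some factor. A lift to
that factor of an element of order q has a power, with exponent prime to q, that is a q-element and
so lies in `N`. -/
theorem not_dvd_index [Finite G] (h : IsPairwiseMutuallyPermutableProduct H) {q : ℕ}
    (hq : q.Prime) (N : Subgroup G) [N.Normal]
    (hN : ∀ i, ∀ x ∈ H i, ∀ k : ℕ, x ^ q ^ k = 1 → x ∈ N) : ¬ q ∣ N.index := by
  intro hd
  let f := QuotientGroup.mk' N
  have hf := h.map f (QuotientGroup.mk'_surjective N)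
  obtain ⟨i, hi⟩ := (coe_iSup_eq_prod _ hf.permute).2 q hq (by
    rw [hf.iSup_eq_top, Subgroup.card_top]
    exact hd)
  have := Fact.mk hq
  obtain ⟨⟨z, hz⟩, hzq⟩ := exists_prime_orderOf_dvd_card' q hi
  rw [Subgroup.orderOf_mk] at hzq
  obtain ⟨x, hx, rfl⟩ := hz
  obtain ⟨m, hm, k, hk⟩ := exists_primary_pow hq x
  have h1 : f x ^ m = 1 := by
    rw [← map_pow]
    exact (QuotientGroup.eq_one_iff _).2 (hN i _ ((H i).pow_mem hx m) k hk)
  exact hm (hzq ▸ orderOf_dvd_of_pow_eq_one h1)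

end IsPairwiseMutuallyPermutableProduct

end PermutableProducts

/-- For the largest prime p, the normal Sylow p-subgroups of the factors generate a normal Sylow
subgroup `W` of G. Since G/W is again a product of the same kind, induction applies, and
`of_quotient` needs only the action on `W`. -/
theorem IsPairwiseMutuallyPermutableProduct.hasSupersolubleTypeTower {G : Type*} [Group G]
    [Finite G] {n : ℕ} {H : Fin n → Subgroup G} (h : IsPairwiseMutuallyPermutableProduct H)
    (hH : ∀ i, HasSupersolubleTypeTower (H i)) : HasSupersolubleTypeTower G := by
  induction hN : Nat.card G using Nat.strong_induction_on generalizing G with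
  | _ N ih =>
  by_cases h1 : Nat.card G = 1
  · exact .of_card_eq_one h1
  have h0 : Nat.card G ≠ 0 := Nat.card_pos.ne'
  obtain ⟨p, hpm⟩ : ∃ p, Maximal (· ∈ (Nat.card G).primeFactors) p :=
    Finset.exists_maximal (Nat.nonempty_primeFactors.2 (by omega))
  have hp : p.Prime := Nat.prime_of_mem_primeFactors hpm.1
  have hpG : p ∣ Nat.card G := Nat.dvd_of_mem_primeFactors hpm.1
  have hmax : ∀ s : ℕ, s.Prime → s ∣ Nat.card G → s ≤ p := fun s hs hd =>
    (le_total s p).elim id fun hle => hpm.2 (Nat.mem_primeFactors.2 ⟨hs, hd, h0⟩) hle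
  have hpf := Fact.mk hp
  have hP' := fun i => (hH i).exists_isNormalSylow hp fun s hs hd =>
    hmax s hs (hd.trans (H i).card_subgroup_dvd_card)
  choose P hP using hP'
  have hlt {q : ℕ} (hq : q.Prime) (hqp : q ≠ p) {x : G} (hx1 : x ≠ 1) {k : ℕ}
      (hx : x ^ q ^ k = 1) : q < p := by
    refine lt_of_le_of_ne (hmax q hq ?_) hqp
    have := dvd_card_of_primary_mem hq (Subgroup.mem_top x) hx hx1
    rwa [Subgroup.card_top] at this
  have conj {q : ℕ} (hq : q.Prime) (hqp : q ≠ p) {i : Fin n} {x : G} (hx : x ∈ H i) {k : ℕ}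
      (hxk : x ^ q ^ k = 1) (j : Fin n) : ∀ u ∈ P j, x * u * x⁻¹ ∈ P j := by
    intro u hu
    by_cases hx1 : x = 1
    · simpa [hx1] using hu
    by_cases hij : i = j
    · subst hij
      exact (hP i).conj_mem x hx u hu
    · exact (h.2 i j hij).conj_mem_normalSylow hp hq (hlt hq hqp hx1 hxk) (hP j) hx hxk u hu
  let W := ⨆ i, P i
  have hPW : ∀ i, P i ≤ W := le_iSup P
  have hWp : IsPGroup p W := by
    refine isPGroup_of_forall_prime_dvd hp fun s hs hd => ?_
    obtain ⟨i, hi⟩ := (coe_iSup_eq_prod P fun i j => by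
      by_cases hij : i = j
      · subst hij
        exact rfl
      · exact (h.2 i j hij).permute_normalSylow (hP i) (hP j)).2 s hs hd
    exact eq_of_prime_dvd_card_of_isPGroup hp hs (hP i).isPGroup hi
  have hWn : W.Normal := by
    rw [← Subgroup.normalizer_eq_top_iff, eq_top_iff, ← h.iSup_eq_top, iSup_le_iff]
    refine fun i => le_of_primary_mem fun q hq x hx k hxk => ?_
    by_cases hqp : q = p
    · subst hqp
      exact Subgroup.le_normalizer (hPW i ((hP i).mem_of_primary x hx k hxk))
    · refine Subgroup.mem_normalizer_fintype fun u hu => ?_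
      have hle : W ≤ W.comap (MulAut.conj x).toMonoidHom :=
        iSup_le fun j v hv => hPW j (conj hq hqp hx hxk j v hv)
      exact hle hu
  have hWi : ¬ p ∣ W.index := h.not_dvd_index hp W fun i x hx k hxk =>
    hPW i ((hP i).mem_of_primary x hx k hxk)
  refine .of_quotient hp hmax W hWp hWi ?_ fun q hq hqp hq1 => ?_
  · have hpW : p ∣ Nat.card W := by
      rw [← W.card_mul_index] at hpG
      exact (hp.dvd_mul.1 hpG).resolve_right hWi
    have hcard : Nat.card (G ⧸ W) < N := by
      have h2 : Nat.card W * Nat.card (G ⧸ W) = N := hN ▸ W.card_mul_index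
      have h3 : 1 < Nat.card W := lt_of_lt_of_le hp.one_lt (Nat.le_of_dvd Nat.card_pos hpW)
      have h4 : 0 < Nat.card (G ⧸ W) := Nat.card_pos
      nlinarith
    refine ih _ hcard (h.map (QuotientGroup.mk' W) (QuotientGroup.mk'_surjective W))
      (fun i => ?_) rfl
    exact (hH i).of_surjective ((QuotientGroup.mk' W).subgroupMap (H i))
      ((QuotientGroup.mk' W).subgroupMap_surjective (H i))
  · refine h.not_dvd_index hq _ fun i x hx k hxk => ?_
    have hcomm : ∀ u ∈ P i, Commute x u := fun u hu =>
      (hH i).coprimeActionsTrivial.commute_of_mem hp hq hqp.symm hq1 (hP i).isPGroup (hP i).le hx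
        hxk ((hP i).conj_mem x hx) hu
    have hle : W ≤ Subgroup.centralizer {x} := by
      refine iSup_le fun j u hu => ?_
      rw [Subgroup.mem_centralizer_singleton_iff]
      by_cases hij : i = j
      · subst hij
        exact (hcomm u hu).symm
      · exact ((h.2 i j hij).commute_normalSylow hp hq hqp.symm hq1 (hP i) (hP j) hx hxk hcomm
          (conj hq hqp hx hxk j) u hu).symm
    rw [Subgroup.mem_centralizer_iff]
    exact fun u hu => Subgroup.mem_centralizer_singleton_iff.1 (hle hu)

/-! ### Structure of Schmidt groups with a tower. -/

theorem exists_eq_nsmul_of_pow_eq {V : Type*} [AddCommGroup V] [Finite V] [Nontrivial V] {r : ℕ}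
    [Fact r.Prime] [Module (ZMod r) V] (f : Module.End (ZMod r) V) (hf : f ^ r = f) :
    ∃ v : V, v ≠ 0 ∧ ∃ m : ℕ, f v = m • v := by
  have hr : r.Prime := Fact.out
  have hfin : Module.Finite (ZMod r) V := Module.Finite.of_finite
  -- The minimal polynomial divides X^r - X, which splits over the field with r elements, so an
  -- eigenvalue exists.
  have hF : Polynomial.aeval f (Polynomial.X ^ r - Polynomial.X : Polynomial (ZMod r)) = 0 := by
    rw [map_sub, map_pow, Polynomial.aeval_X, hf, sub_self]
  have hsplit : (Polynomial.X ^ r - Polynomial.X : Polynomial (ZMod r)).Splits := by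
    have := FiniteField.splits_X_pow_card_sub_X r (K := ZMod r)
    simpa using this
  have hne : (Polynomial.X ^ r - Polynomial.X : Polynomial (ZMod r)) ≠ 0 :=
    FiniteField.X_pow_card_sub_X_ne_zero _ hr.one_lt
  have hdvd := minpoly.dvd (ZMod r) f hF
  obtain ⟨μ, hμ⟩ := (hsplit.of_dvd hne hdvd).exists_eval_eq_zero
    (minpoly.degree_pos (Algebra.IsIntegral.isIntegral f)).ne'
  obtain ⟨v, hv⟩ := (Module.End.hasEigenvalue_of_isRoot hμ).exists_hasEigenvector
  refine ⟨v, hv.2, μ.val, ?_⟩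
  have h1 := hv.apply_eq_smul
  rwa [← ZMod.natCast_zmod_val μ, Nat.cast_smul_eq_nsmul] at h1

theorem exists_eq_pow_of_iterate_eq {V : Type*} [CommGroup V] [Finite V] [Nontrivial V] {r : ℕ}
    (hr : r.Prime) (hexp : ∀ v : V, v ^ r = 1) (f : V →* V) (hf : ∀ v, f^[r] v = f v) :
    ∃ v : V, v ≠ 1 ∧ ∃ m : ℕ, f v = v ^ m := by
  have hrf := Fact.mk hr
  let inst : Module (ZMod r) (Additive V) := AddCommGroup.zmodModule fun v => hexp v.toMul
  obtain ⟨v, hv, m, hm⟩ := exists_eq_nsmul_of_pow_eq (r := r)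
    ((MonoidHom.toAdditive f).toZModLinearMap r) (by
      ext v
      rw [Module.End.pow_apply]
      exact hf v.toMul)
  exact ⟨v.toMul, hv, m, hm⟩

namespace IsSchmidtGroup

variable {S : Type*} [Group S] [Finite S]

/-- A Schmidt group with a Sylow tower is generated by a normal Sylow subgroup and an element of
prime power order. -/
theorem exists_sup_zpowers_eq_top (hS : IsSchmidtGroup S) (hT : HasSupersolubleTypeTower S) :
    ∃ (r q : ℕ) (R : Subgroup S) (y : S) (k : ℕ), r.Prime ∧ q.Prime ∧ r ≠ q ∧ R.Normal ∧
      IsPGroup r R ∧ y ^ q ^ k = 1 ∧ R ⊔ Subgroup.zpowers y = ⊤ ∧ ∃ u ∈ R, ¬ Commute y u := by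
  have h1 : Nat.card S ≠ 1 := fun h1 => hS.1 <| by
    have := (Nat.card_eq_one_iff_unique.1 h1).1
    infer_instance
  have h0 : Nat.card S ≠ 0 := Nat.card_pos.ne'
  obtain ⟨r, hrm⟩ : ∃ r, Maximal (· ∈ (Nat.card S).primeFactors) r :=
    Finset.exists_maximal (Nat.nonempty_primeFactors.2 (by omega))
  have hr : r.Prime := Nat.prime_of_mem_primeFactors hrm.1
  have hrf := Fact.mk hr
  have hrS : r ∣ Nat.card S := Nat.dvd_of_mem_primeFactors hrm.1
  obtain ⟨R, hRn, hR, hRi⟩ := hT.exists_normal_sylow hr fun s hs hd =>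
    (le_total s r).elim id fun hle => hrm.2 (Nat.mem_primeFactors.2 ⟨hs, hd, h0⟩) hle
  have hmem {x : S} {j : ℕ} (hx : x ^ r ^ j = 1) : x ∈ R :=
    mem_of_primary_of_not_dvd_index hr hRi hx
  by_cases H : ∃ q : ℕ, q.Prime ∧ r ≠ q ∧ ∃ (y : S) (k : ℕ), y ^ q ^ k = 1 ∧
      ∃ u ∈ R, ¬ Commute y u
  · obtain ⟨q, hq, hrq, y, k, hy, u, hu, hyu⟩ := H
    refine ⟨r, q, R, y, k, hr, hq, hrq, hRn, hR, hy, ?_, u, hu, hyu⟩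
    -- If R⟨y⟩ were proper it would be nilpotent, and `y` would commute with `u`.
    by_contra htop
    obtain ⟨j, hj⟩ := exists_pow_prime_pow_eq_one_of_mem hR hu
    have hc := commute_of_isNilpotent (hS.2 _ htop) hq hr hrq.symm
      (x := ⟨y, Subgroup.mem_sup_right (Subgroup.mem_zpowers y)⟩)
      (y := ⟨u, Subgroup.mem_sup_left hu⟩) (j := k) (k := j)
      (Subtype.ext (by simpa using hy)) (Subtype.ext (by simpa using hj))
    exact hyu (congrArg Subtype.val hc)
  push Not at H
  exfalso
  have hcop : Nat.Coprime (Nat.card R) R.index := by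
    obtain ⟨m, hm⟩ := IsPGroup.iff_card.1 hR
    rw [hm]
    exact Nat.Coprime.pow_left m ((Nat.Prime.coprime_iff_not_dvd hr).2 hRi)
  -- Here every q-element with q ≠ r centralizes `R`, so S = R × K with `K` proper, hence nilpotent.
  -- This would make `S` nilpotent.
  obtain ⟨K, hK⟩ := Subgroup.exists_right_complement'_of_coprime hcop
  have hKR : K ≤ Subgroup.centralizer (R : Set S) := by
    refine le_of_primary_mem fun q hq x hx k hxk => ?_
    by_cases hrq : r = q
    · subst hrq
      have hx1 : x = 1 := (Subgroup.disjoint_def.1 hK.disjoint) (hmem hxk) hx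
      rw [hx1]
      exact Subgroup.one_mem _
    · rw [Subgroup.mem_centralizer_iff]
      exact fun u hu => (H q hq hrq x k hxk u hu).symm
  have hKn : K.Normal := by
    rw [← Subgroup.normalizer_eq_top_iff, eq_top_iff, ← hK.sup_eq_top]
    refine sup_le ?_ Subgroup.le_normalizer
    exact (Subgroup.le_centralizer_iff.1 hKR).trans (Subgroup.centralizer_le_normalizer _)
  have hKi : K.index = Nat.card R := hK.index_eq_card
  have hKtop : K ≠ ⊤ := by
    intro he
    rw [he, Subgroup.index_top] at hKi
    rw [← R.card_mul_index, ← hKi, one_mul] at hrS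
    exact hRi hrS
  have memK {q : ℕ} (hq : q.Prime) (hqr : r ≠ q) {x : S} {j : ℕ} (hx : x ^ q ^ j = 1) : x ∈ K :=
    mem_of_primary_of_not_dvd_index hq (fun hd => hqr
      (eq_of_prime_dvd_card_of_isPGroup hr hq hR (hKi ▸ hd)).symm) hx
  refine hS.1 (isNilpotent_of_primary_commute fun p q hp hq hpq x y j k hx hy => ?_)
  by_cases hrp : r = p
  · subst hrp
    exact (H q hq hpq y k hy x (hmem hx)).symm
  by_cases hrq : r = q
  · subst hrq
    exact H p hp hrp x j hx y (hmem hy)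
  have hc := commute_of_isNilpotent (hS.2 _ hKtop) hp hq hpq
    (x := ⟨x, memK hp hrp hx⟩) (y := ⟨y, memK hq hrq hy⟩) (j := j) (k := k)
    (Subtype.ext (by simpa using hx)) (Subtype.ext (by simpa using hy))
  exact congrArg Subtype.val hc

section Structure

variable {r q k : ℕ} {R : Subgroup S} {y : S}

/-- A proper `y`-invariant subgroup of `R` is centralized by `y`. -/
theorem commute_of_invariant (hS : IsSchmidtGroup S) (hr : r.Prime) (hq : q.Prime) (hrq : r ≠ q)
    (hR : IsPGroup r R) (hy : y ^ q ^ k = 1) {M : Subgroup S} (hMR : M ≤ R) (hne : M ≠ R)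
    (hyM : ∀ m ∈ M, y * m * y⁻¹ ∈ M) : ∀ m ∈ M, Commute y m := by
  intro m hm
  have htop : M ⊔ Subgroup.zpowers y ≠ ⊤ := by
    refine fun he => hne (le_antisymm hMR fun x hx => ?_)
    obtain ⟨j, hj⟩ := exists_pow_prime_pow_eq_one_of_mem hR hx
    exact mem_of_mem_sup_zpowers_of_primary hr hq hrq hyM hy (he ▸ Subgroup.mem_top x) hj
  obtain ⟨j, hj⟩ := exists_pow_prime_pow_eq_one_of_mem hR (hMR hm)
  have hc := commute_of_isNilpotent (hS.2 _ htop) hq hr hrq.symm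
    (x := ⟨y, Subgroup.mem_sup_right (Subgroup.mem_zpowers y)⟩)
    (y := ⟨m, Subgroup.mem_sup_left hm⟩) (j := k) (k := j)
    (Subtype.ext (by simpa using hy)) (Subtype.ext (by simpa using hj))
  exact congrArg Subtype.val hc

/-- R⟨y^q⟩ is proper, hence nilpotent: otherwise y^(1 - qi) ∈ R for some i, which is then trivial,
and 1 - qi is prime to the order of `y`. -/
theorem commute_pow (hS : IsSchmidtGroup S) (hr : r.Prime) (hq : q.Prime) (hrq : r ≠ q)
    [hRn : R.Normal] (hR : IsPGroup r R) (hy : y ^ q ^ k = 1) (hy1 : y ≠ 1) :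
    ∀ u ∈ R, Commute (y ^ q) u := by
  intro u hu
  have hyq : (y ^ q) ^ q ^ k = 1 := by rw [← pow_mul, mul_comm, pow_mul, hy, one_pow]
  have htop : R ⊔ Subgroup.zpowers (y ^ q) ≠ ⊤ := by
    intro he
    obtain ⟨v, hv, i, hi⟩ := exists_mul_zpow_of_mem_sup_zpowers
      (fun u hu => hRn.conj_mem u hu (y ^ q)) (he ▸ Subgroup.mem_top y)
    have hv' : v = y ^ (1 - q * i : ℤ) := by
      rw [zpow_sub, zpow_one, zpow_mul, zpow_natCast]
      exact eq_mul_inv_of_mul_eq hi.symm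
    obtain ⟨j, hj⟩ := exists_pow_prime_pow_eq_one_of_mem hR hv
    have hv1 : v = 1 := by
      refine eq_one_of_pow_prime_pow hr hq hrq hj (k := k) ?_
      rw [hv', ← zpow_natCast, ← zpow_mul, mul_comm, zpow_mul, zpow_natCast, hy, one_zpow]
    have hcop : IsCoprime (1 - q * i : ℤ) ((q : ℤ) ^ k) :=
      IsCoprime.pow_right ⟨1, i, by ring⟩
    obtain ⟨a, b, hab⟩ := hcop
    refine hy1 ?_
    have hy' : y ^ ((q : ℤ) ^ k) = 1 := by exact_mod_cast hy
    calc y = y ^ (a * (1 - q * i) + b * (q : ℤ) ^ k) := by rw [hab, zpow_one]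
      _ = 1 := by
        rw [zpow_add, mul_comm a, mul_comm b, zpow_mul, zpow_mul, ← hv', hv1, hy', one_zpow,
          one_zpow, one_mul]
  obtain ⟨j, hj⟩ := exists_pow_prime_pow_eq_one_of_mem hR hu
  have hc := commute_of_isNilpotent (hS.2 _ htop) hq hr hrq.symm
    (x := ⟨y ^ q, Subgroup.mem_sup_right (Subgroup.mem_zpowers _)⟩)
    (y := ⟨u, Subgroup.mem_sup_left hu⟩) (j := k) (k := j)
    (Subtype.ext (by simpa using hyq)) (Subtype.ext (by simpa using hj))
  exact congrArg Subtype.val hc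

end Structure

end IsSchmidtGroup

theorem isSupersolubleGroup_of_isCyclic {S : Type*} [Group S] {R : Subgroup S} [R.Normal] {t y : S}
    (ht : R ≤ Subgroup.zpowers t) (hy : R ⊔ Subgroup.zpowers y = ⊤) :
    IsSupersolubleGroup S := by
  have hRc : IsCyclic R := isCyclic_of_injective (Subgroup.inclusion ht)
    (Subgroup.inclusion_injective ht)
  let N : ℕ → Subgroup S := fun i => if i = 0 then ⊥ else if i = 1 then R else ⊤
  have hN : ∀ i, (N i).Normal := by
    intro i
    simp only [N]
    split_ifs <;> infer_instance
  refine ⟨2, N, hN, rfl, rfl, fun i hi => ?_⟩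
  obtain rfl | rfl : i = 0 ∨ i = 1 := by omega
  · refine ⟨bot_le, ?_⟩
    exact isCyclic_of_surjective (QuotientGroup.mk' ((N 0).subgroupOf (N 1)))
      (QuotientGroup.mk'_surjective _) (hH := hRc)
  · refine ⟨le_top, ⟨QuotientGroup.mk ⟨y, Subgroup.mem_top y⟩, fun x => ?_⟩⟩
    obtain ⟨⟨x, hx⟩, rfl⟩ := QuotientGroup.mk_surjective x
    have hx' : x ∈ Subgroup.zpowers y ⊔ R := by
      rw [sup_comm, hy]
      exact hx
    obtain ⟨z, hz, u, hu, hzu⟩ := Subgroup.mem_sup_of_normal_right.1 hx'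
    obtain ⟨i, rfl⟩ := Subgroup.mem_zpowers_iff.1 hz
    refine ⟨i, ?_⟩
    refine (QuotientGroup.eq (s := (N 1).subgroupOf (N 2)) (a := ⟨y, Subgroup.mem_top y⟩ ^ i)
      (b := ⟨x, hx⟩)).2 ?_
    change (y ^ i)⁻¹ * x ∈ R
    rwa [← hzu, inv_mul_cancel_left]

/-- If `y` induces on the normal `r`-subgroup `R` an automorphism of order dividing `r - 1`, and
every proper `y`-invariant subgroup of `R` lies in the proper normal subgroup `C`, then `R / C` is
cyclic. -/
theorem exists_sup_zpowers_eq_of_invariant {S : Type*} [Group S] [Finite S] {r : ℕ} (hr : r.Prime)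
    {R C : Subgroup S} [hRn : R.Normal] [hCn : C.Normal] (hR : IsPGroup r R) (hCR : C < R) {y : S}
    (hyr : ∀ u ∈ R, Commute (y ^ (r - 1)) u)
    (hmax : ∀ M ≤ R, M ≠ R → (∀ m ∈ M, y * m * y⁻¹ ∈ M) → M ≤ C) :
    ∃ x ∈ R, x ∉ C ∧ C ⊔ Subgroup.zpowers x = R := by
  have hrf := Fact.mk hr
  let N := C.subgroupOf R
  let f := QuotientGroup.mk' N
  have hf : ∀ x : R, f x = 1 ↔ (x : S) ∈ C := fun x => QuotientGroup.eq_one_iff _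
  have hRbot : R ≠ ⊥ := fun he => not_lt_bot (he ▸ hCR)
  -- R/C is made a vector space over the field with r elements: ⁅R, R⁆ and, below, the preimage of
  -- the r-torsion are invariant under `y`, so each is `R` or lies in `C`.
  have hcomm : ⁅R, R⁆ ≤ C := by
    refine hmax _ (Subgroup.commutator_le_left R R) (fun he => ?_)
      fun m hm => (inferInstance : ⁅R, R⁆.Normal).conj_mem m hm y
    have hnt : Nontrivial R := (Subgroup.nontrivial_iff_ne_bot _).2 hRbot
    have hnil : Group.IsNilpotent R := hR.isNilpotent
    refine (Group.IsSolvable.commutator_lt_top_of_nontrivial R).not_ge fun x _ => ?_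
    obtain ⟨z, hz, hzx⟩ := (Subgroup.map_subtype_commutator R).ge (he.ge x.2)
    rwa [← Subtype.ext (show (z : S) = x from hzx)]
  let _ : CommGroup (R ⧸ N) :=
    { (inferInstance : Group (R ⧸ N)) with
      mul_comm := fun a b => by
        obtain ⟨a, rfl⟩ := QuotientGroup.mk'_surjective N a
        obtain ⟨b, rfl⟩ := QuotientGroup.mk'_surjective N b
        have h1 : f ⁅a, b⁆ = 1 :=
          (hf _).2 (hcomm (Subgroup.commutator_mem_commutator a.2 b.2))
        rw [map_commutatorElement] at h1
        exact (commutatorElement_eq_one_iff_mul_comm.1 h1) }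
  have hnt : Nontrivial (R ⧸ N) := by
    obtain ⟨x, hx, hxC⟩ := SetLike.exists_of_lt hCR
    exact ⟨f ⟨x, hx⟩, 1, fun h => hxC ((hf _).1 h)⟩
  let σ : R →* R := (MulAut.conjNormal y).toMonoidHom
  have hσ : ∀ x : R, ((σ x : R) : S) = y * x * y⁻¹ := fun x => MulAut.conjNormal_apply y x
  let τ : R ⧸ N →* R ⧸ N := QuotientGroup.map N N σ fun x hx => by
    change ((σ x : R) : S) ∈ C
    rw [hσ]
    exact hCn.conj_mem x hx y
  have hτ : ∀ x : R, τ (f x) = f (σ x) := fun x => rfl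
  have hexp : ∀ v : R ⧸ N, v ^ r = 1 := by
    let M := ((powMonoidHom r : R ⧸ N →* R ⧸ N).ker.comap f).map R.subtype
    have hM : ∀ x : R, (x : S) ∈ M ↔ f x ^ r = 1 := fun x =>
      ⟨fun ⟨z, hz, hzx⟩ => Subtype.ext hzx ▸ hz, fun h => ⟨x, h, rfl⟩⟩
    have hMR : M = R := by
      by_contra hne
      have hMC := hmax M (Subgroup.map_subtype_le _) hne (by
        rintro _ ⟨x, hx, rfl⟩
        have h1 : f (σ x) ^ r = 1 := by
          rw [← hτ, ← map_pow, show f x ^ r = 1 from hx, map_one]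
        have h2 := (hM (σ x)).2 h1
        rwa [hσ] at h2)
      have hd : r ∣ Nat.card (R ⧸ N) := by
        have h1 := (hR.to_quotient N).card_eq_or_dvd
        exact h1.resolve_left Finite.one_lt_card.ne'
      obtain ⟨v, hv⟩ := exists_prime_orderOf_dvd_card' r hd
      obtain ⟨x, hx⟩ := QuotientGroup.mk'_surjective N v
      have h2 : orderOf (f x) = r := hx ▸ hv
      have h1 : f x = 1 := (hf x).2 (hMC ((hM x).2 (h2 ▸ pow_orderOf_eq_one _)))
      rw [h1, orderOf_one] at h2
      exact hr.ne_one h2.symm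
    intro v
    obtain ⟨x, rfl⟩ := QuotientGroup.mk'_surjective N v
    exact (hM x).1 (hMR.ge x.2)
  -- Since y^(r-1) centralizes `R`, the induced map satisfies τ^r = τ and has an eigenvector. Its
  -- preimage `x` makes C⟨x⟩ invariant but not contained in `C`, hence equal to `R`.
  have hiter : ∀ v, τ^[r] v = τ v := by
    intro v
    obtain ⟨x, rfl⟩ := QuotientGroup.mk'_surjective N v
    have h1 : ∀ n : ℕ, ∃ z : R, τ^[n] (f x) = f z ∧ (z : S) = y ^ n * x * (y ^ n)⁻¹ := by
      intro n
      induction n with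
      | zero => exact ⟨x, rfl, by simp⟩
      | succ n ih =>
        obtain ⟨z, hz, hzx⟩ := ih
        refine ⟨σ z, by rw [Function.iterate_succ_apply', hz, hτ], ?_⟩
        rw [hσ, hzx, pow_succ']
        group
    obtain ⟨z, hz, hzx⟩ := h1 (r - 1)
    rw [(hyr x x.2).eq, mul_inv_cancel_right] at hzx
    have h2 : τ^[r] (f x) = τ (τ^[r - 1] (f x)) := by
      rw [← Function.iterate_succ_apply' τ, Nat.succ_eq_add_one, Nat.sub_add_cancel hr.one_le]
    change τ^[r] (f x) = τ (f x)
    rw [h2, hz, Subtype.ext hzx]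
  obtain ⟨v, hv1, m, hm⟩ := exists_eq_pow_of_iterate_eq hr hexp τ hiter
  obtain ⟨x, rfl⟩ := QuotientGroup.mk'_surjective N v
  have hxC : (x : S) ∉ C := fun h => hv1 ((hf x).2 h)
  have hyx : ((x : S) ^ m)⁻¹ * (y * x * y⁻¹) ∈ C := by
    have h1 : f (x ^ m) = f (σ x) := by rw [map_pow]; exact hm.symm
    have h2 := QuotientGroup.eq.1 h1
    have h3 : (((x ^ m)⁻¹ * σ x : R) : S) ∈ C := h2
    rwa [Subgroup.coe_mul, Subgroup.coe_inv, Subgroup.coe_pow, hσ] at h3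
  refine ⟨x, x.2, hxC, ?_⟩
  by_contra hne
  refine hxC (hmax _ (sup_le hCR.le (by rw [Subgroup.zpowers_le]; exact x.2)) hne ?_
    (Subgroup.mem_sup_right (Subgroup.mem_zpowers _)))
  have hyx' : y * x * y⁻¹ ∈ C ⊔ Subgroup.zpowers (x : S) := by
    have := Subgroup.mul_mem _ (Subgroup.mem_sup_right (S := C)
      (Subgroup.pow_mem _ (Subgroup.mem_zpowers (x : S)) m)) (Subgroup.mem_sup_left hyx)
    rwa [mul_inv_cancel_left] at this
  have hle : C ⊔ Subgroup.zpowers (x : S) ≤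
      (C ⊔ Subgroup.zpowers (x : S)).comap (MulAut.conj y).toMonoidHom := by
    refine sup_le (fun c hc => Subgroup.mem_sup_left (hCn.conj_mem c hc y)) ?_
    rw [Subgroup.zpowers_le]
    exact hyx'
  exact fun z hz => hle hz

/-- C = C_R(y) contains every proper `y`-invariant subgroup of `R`. This makes `C` normal and
central in `R` with R/C cyclic, so `R` is abelian, and then generated by a single commutator with
`y`. -/
theorem IsSchmidtGroup.isSupersolubleGroup {S : Type*} [Group S] [Finite S]
    (hS : IsSchmidtGroup S) (hT : HasSupersolubleTypeTower S) : IsSupersolubleGroup S := by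
  obtain ⟨r, q, R, y, k, hr, hq, hrq, hRn, hR, hy, htop, u₀, hu₀, hyu₀⟩ :=
    hS.exists_sup_zpowers_eq_top hT
  have hrf := Fact.mk hr
  have hyR : ∀ u ∈ R, y * u * y⁻¹ ∈ R := fun u hu => hRn.conj_mem u hu y
  have hqr : q ∣ r - 1 := by
    by_contra hqr
    exact hyu₀ (hT.coprimeActionsTrivial r q hr hq hrq hqr R hR y k hy hyR u₀ hu₀)
  have hy1 : y ≠ 1 := by
    rintro rfl
    exact hyu₀ (Commute.one_left u₀)
  have hyq := hS.commute_pow hr hq hrq hR hy hy1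
  have hinv {M : Subgroup S} := hS.commute_of_invariant hr hq hrq hR hy (M := M)
  let C := R ⊓ Subgroup.centralizer {y}
  have memC {x : S} (hx : x ∈ R) (hxy : Commute y x) : x ∈ C :=
    ⟨hx, Subgroup.mem_centralizer_singleton_iff.2 hxy.symm⟩
  have commC {x : S} (hx : x ∈ C) : Commute y x :=
    (Subgroup.mem_centralizer_singleton_iff.1 hx.2).symm
  have hCR : C < R := lt_of_le_of_ne inf_le_left fun he => hyu₀ (commC (he ▸ hu₀))
  have hmax : ∀ M ≤ R, M ≠ R → (∀ m ∈ M, y * m * y⁻¹ ∈ M) → M ≤ C := fun M hM hne hyM m hm =>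
    memC (hM hm) (hinv hM hne hyM m hm)
  have hyC : y ∈ Subgroup.normalizer (C : Set S) :=
    Subgroup.mem_normalizer_fintype fun c hc => by
      rw [(commC hc).eq, mul_inv_cancel_right]
      exact hc
  have hCn : C.Normal := by
    have hlt := hR.lt_inf_normalizer hCR
    -- The normalizer of `C` in `R` is `y`-invariant and strictly larger than `C`, so it is all of
    -- `R`.
    have hRC : R ≤ Subgroup.normalizer (C : Set S) := by
      by_contra hle
      refine hlt.not_ge (hmax _ inf_le_left (fun he => hle (inf_eq_left.1 he)) fun m hm => ?_)
      exact ⟨hyR m hm.1, Subgroup.mul_mem _ (Subgroup.mul_mem _ hyC hm.2) (Subgroup.inv_mem _ hyC)⟩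
    rw [← Subgroup.normalizer_eq_top_iff, eq_top_iff, ← htop]
    exact sup_le hRC (by rwa [Subgroup.zpowers_le])
  -- a commutator with `y` that commutes with `y` is trivial
  have triv {x d : S} (hx : x ∈ R) (hd : d ∈ C) (h : y * x * y⁻¹ = x * d) : x ∈ C := by
    obtain ⟨j, hj⟩ := exists_pow_prime_pow_eq_one_of_mem hR hd.1
    have hd1 := eq_one_of_conj_eq_mul hr hq hrq hy hj (commC hd) h
    rw [hd1, mul_one] at h
    exact memC hx (mul_inv_eq_iff_eq_mul.1 h)
  have hcent : R ≤ Subgroup.centralizer (C : Set S) := by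
    by_contra hle
    have hE : R ⊓ Subgroup.centralizer (C : Set S) ≤ C :=
      hmax _ inf_le_left (fun he => hle (inf_eq_left.1 he))
        fun m hm => (inferInstance : (R ⊓ Subgroup.centralizer (C : Set S)).Normal).conj_mem m hm y
    refine hyu₀ (commC (triv hu₀ (hE ?_) (mul_inv_cancel_left u₀ _).symm))
    refine ⟨R.mul_mem (R.inv_mem hu₀) (hyR _ hu₀), Subgroup.mem_centralizer_iff.2 fun c hc => ?_⟩
    have h1 := (commC (hCn.conj_mem c hc u₀)).eq
    have h2 := (commC hc).inv_left.eq
    -- As `y` centralizes `C` and its conjugates by `u₀`, the elements `u₀` and y u₀ y⁻¹ act alike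
    -- on `C`; so u₀⁻¹ y u₀ y⁻¹ centralizes `C`.
    have h3 : y * u₀ * y⁻¹ * c = u₀ * c * u₀⁻¹ * (y * u₀ * y⁻¹) := by
      calc y * u₀ * y⁻¹ * c = y * u₀ * (y⁻¹ * c) := by group
        _ = (y * (u₀ * c * u₀⁻¹)) * (u₀ * y⁻¹) := by rw [h2]; group
        _ = u₀ * c * u₀⁻¹ * (y * u₀ * y⁻¹) := by rw [h1]; group
    rw [mul_assoc u₀⁻¹, h3]
    group
  obtain ⟨x, hx, hxC, hCx⟩ := exists_sup_zpowers_eq_of_invariant hr hR hCR (fun u hu => by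
    obtain ⟨m, hm⟩ := hqr
    rw [hm, pow_mul]
    exact (hyq u hu).pow_left m) hmax
  have commCR {c u : S} (hc : c ∈ C) (hu : u ∈ R) : Commute c u :=
    Subgroup.mem_centralizer_iff.1 (hcent hu) c hc
  have fact : ∀ u ∈ R, ∃ c ∈ C, ∃ i : ℤ, u = c * x ^ i := by
    intro u hu
    obtain ⟨c, hc, z, hz, rfl⟩ := Subgroup.mem_sup_of_normal_left.1 (hCx.symm ▸ hu)
    obtain ⟨i, rfl⟩ := Subgroup.mem_zpowers_iff.1 hz
    exact ⟨c, hc, i, rfl⟩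
  have hab : ∀ u ∈ R, ∀ v ∈ R, Commute u v := by
    intro u hu v hv
    obtain ⟨c, hc, i, rfl⟩ := fact u hu
    refine (commCR hc hv).mul_left ?_
    obtain ⟨d, hd, j, rfl⟩ := fact v hv
    exact ((commCR hd (R.zpow_mem hx i)).symm).mul_right ((Commute.refl x).zpow_zpow i j)
  let t := ⁅y, x⁆
  have ht : t = y * x * y⁻¹ * x⁻¹ := commutatorElement_def y x
  have htR : t ∈ R := ht ▸ R.mul_mem (hyR x hx) (R.inv_mem hx)
  have hyx : y * x * y⁻¹ = t * x := by rw [ht]; group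
  have himage : ∀ u ∈ R, ∃ i : ℤ, y * u * y⁻¹ = t ^ i * u := by
    intro u hu
    obtain ⟨c, hc, i, rfl⟩ := fact u hu
    refine ⟨i, ?_⟩
    calc y * (c * x ^ i) * y⁻¹ = (y * c) * x ^ i * y⁻¹ := by group
      _ = c * (y * x * y⁻¹) ^ i := by rw [(commC hc).eq, conj_zpow]; group
      _ = c * t ^ i * x ^ i := by rw [hyx, (hab t htR x hx).mul_zpow, mul_assoc]
      _ = t ^ i * (c * x ^ i) := by rw [(commCR hc (R.zpow_mem htR i)).eq, mul_assoc]
  have htle : Subgroup.zpowers t ≤ R := by rwa [Subgroup.zpowers_le]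
  -- By `himage`, ⟨t⟩ is `y`-invariant. If it were proper, t = ⁅y, x⁆ would commute with `y`,
  -- forcing x ∈ C.
  have hRt : Subgroup.zpowers t = R := by
    by_contra hne
    have htC : Subgroup.zpowers t ≤ C := by
      refine hmax _ htle hne fun m hm => ?_
      obtain ⟨i, hi⟩ := himage m (htle hm)
      rw [hi]
      exact Subgroup.mul_mem _ (Subgroup.zpow_mem _ (Subgroup.mem_zpowers t) i) hm
    refine hxC (triv hx (htC (Subgroup.mem_zpowers t)) ?_)
    rw [hyx, (hab t htR x hx).eq]
  exact isSupersolubleGroup_of_isCyclic hRt.ge htop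

theorem mainTheorem8 {G : Type*} [Group G] [Finite G] (n : ℕ) (H : Fin n → Subgroup G)
    (hprod : IsPairwiseMutuallyPermutableProduct H)
    (hH : ∀ i : Fin n, SchmidtSubgroupsSupersoluble (H i)) :
    SchmidtSubgroupsSupersoluble G := fun S hS =>
  hS.isSupersolubleGroup <|
    (hprod.hasSupersolubleTypeTower fun i =>
      (hH i).coprimeActionsTrivial.hasSupersolubleTypeTower).of_injective S.subtype
        S.subtype_injective
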